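/- **Theorem (CCZ is transversal in stacked 3D surface codes).** Let $d\ge 2$ and $L=2d-2$. *The lattice.* The rectified cubic lattice has as vertices the points $(x,y,z)\in\mathbb Z^3$ with either $x,y,z$ all even, or $z$ and $x+y$ both odd. Its cells are octahedra ($g$-cells), centred at the points (even, even, odd) and having the 6 lattice vertices at distance $1$ from the centre, and cuboctahedra, centred at the points (odd, odd, even) and having the 12 lattice vertices at distance $\sqrt2$ from the centre; a cuboctahedron with centre $(x,y,z)$ is an $r$-cell if $x+y+z\equiv 2 \pmod 4$ and a $b$-cell if $x+y+z\equiv 0\pmod 4$. The common face of two adjacent cells of colours $c\neq c'$ is a $cc'$-face. The distance-$d$ lattice is the part in the cube $[0,L]^3$; let $V$ be its set of vertices. Its cells are the cells with centre in $[0,L]^3$, restricted to $V$. Its $r$-boundaries are $x=0$ and $x=L$, its $b$-boundaries are $y=0$ and $y=L$, and its $g$-boundaries are $z=0$ and $z=L$. *The codes.* At every vertex of $V$ there are three qubits, one for each of the codes $\mathcal{SC}_r,\mathcal{SC}_g,\mathcal{SC}_b$. - The code $\mathcal{SC}_c$ has an $X$ stabilizer on the vertices of each $c$-cell. In addition, $\mathcal{SC}_r$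 has an $X$ stabilizer on each face of a $b$-cuboctahedron that lies on a $b$-boundary (a 2D flattening of an $r$-cell), and $\mathcal{SC}_b$ has an $X$ stabilizer on each face of an $r$-cuboctahedron that lies on an $r$-boundary (a 2D flattening of a $b$-cell). - The code $\mathcal{SC}_g$ has a $Z$ stabilizer on each $rb$-face (all square faces of cuboctahedra of the distance-$d$ lattice, restricted to $V$, including those on the boundaries). - The code $\mathcal{SC}_b$ has a $Z$ stabilizer on each $rg$-face (common face of an $r$-cell and a $g$-cell of the distance-$d$ lattice), and a weight-two $Z$ stabilizer on each edge that is the common part of a 2D flattening of an $r$-cell and a $g$-cell of the distance-$d$ lattice adjacent to the $r$-cell that was flattened. The code $\mathcal{SC}_r$ has $Z$ stabilizers described in the same way with $r$ and $b$ exchanged. *The encoded states.* For each colour $c$ choose one of the two $c$-boundaries, and let $X^c\in\mathbb F_2^V$ be the indicator vector of the vertices on it (the support of the canonical logical operator $\overline X_c$). Let $G_0^c\subseteq\mathbb F_2^V$ be the span of the indicator vectors of the supports of the $X$ stabilizers of $\mathcal{SC}_c$, and $G_1^c=X^c+G_0^c$. Put $$|\overline{\alpha}\rangle_c=\frac1{\sqrt{|G^c_\alpha|}}\sum_{x\in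 G^c_\alpha}|x\rangle_c\quad(\alpha\in\{0,1\}),\qquad |\overline{\alpha\beta\gamma}\rangle=|\overline\alpha\rangle_r|\overline\beta\rangle_g|\overline\gamma\rangle_b .$$ Then, for every choice of the three boundaries: 1. the eight states $|\overline{\alpha\beta\gamma}\rangle$ form an orthonormal basis of the code space of the stack, that is, of the joint $+1$ eigenspace of all the $X$ and $Z$ stabilizers of the three codes (so that the stack encodes three logical qubits); 2. the gate $CCZ^{\otimes V}$, which applies $CCZ$ to the three qubits at every vertex, implements the logical $CCZ$ on them: $CCZ^{\otimes V}|\overline{\alpha\beta\gamma}\rangle=-|\overline{\alpha\beta\gamma}\rangle$ if $\alpha=\beta=\gamma=1$, and $CCZ^{\otimes V}|\overline{\alpha\beta\gamma}\rangle=|\overline{\alpha\beta\gamma}\rangle$ otherwise; 3. for all $\alpha,\beta,\gamma\in\{0,1\}$ and all $t\in G^r_\alpha$, $u\in G^g_\beta$, $v\in G^b_\gamma$, the number of vertices at which $t$, $u$ and $v$ are all equal to $1$ is odd if and only if $\alpha=\beta=\gamma=1$. -/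

import Mathlib

namespace CCZStack

/-- The three colours: they label the cells, the boundaries and the three surface codes. -/
inductive Colour where
  | r
  | g
  | b
  deriving DecidableEq

instance : Fintype Colour where
  elems := {Colour.r, Colour.g, Colour.b}
  complete := by intro c; cases c <;> simp

/-- Points of the integer grid, on which the (infinite) rectified cubic lattice is drawn. -/
abbrev Point : Type := ℤ × ℤ × ℤ

/-- Squared Euclidean distance. -/
def sqDist (p q : Point) : ℤ :=
  (p.1 - q.1) ^ 2 + (p.2.1 - q.2.1) ^ 2 + (p.2.2 - q.2.2) ^ 2

/-! ### The infinite rectified cubic lattice -/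

/-- The vertices of the infinite rectified cubic lattice, layer by layer: the planes with `z` even
are the chequerboard layers and the planes with `z` odd are the diamond layers. -/
def IsSite (p : Point) : Prop :=
  (Even p.2.2 ∧ Even p.1 ∧ Even p.2.1) ∨ (Odd p.2.2 ∧ Odd (p.1 + p.2.1))

instance (p : Point) : Decidable (IsSite p) := by unfold IsSite; infer_instance

/-- `IsCentre c p`: the point `p` is the centre of a cell of colour `c` of the infinite lattice.
The octahedra (`g`) are centred at the points (even, even, odd), the cuboctahedra at the points
(odd, odd, even); cuboctahedra that share a (square) face have different colours `r`, `b`. -/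
def IsCentre : Colour → Point → Prop
  | .g, p => Even p.1 ∧ Even p.2.1 ∧ Odd p.2.2
  | .r, p => Odd p.1 ∧ Odd p.2.1 ∧ Even p.2.2 ∧ (p.1 + p.2.1 + p.2.2) % 4 = 2
  | .b, p => Odd p.1 ∧ Odd p.2.1 ∧ Even p.2.2 ∧ (p.1 + p.2.1 + p.2.2) % 4 = 0

/-- Squared circumradius of a cell: the vertices of a cell are the lattice vertices at this squared
distance from its centre (6 vertices for an octahedron, 12 for a cuboctahedron). -/
def sqRadius : Colour → ℤ
  | .g => 1
  | .r => 2
  | .b => 2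

/-! ### The distance-`d` lattice -/

/-- The side length of the cube occupied by the distance-`d` lattice: `d` chequerboard layers
(`z = 0, 2, …, 2d - 2`) and `d - 1` diamond layers (`z = 1, 3, …, 2d - 3`). -/
def side (d : ℕ) : ℤ := 2 * (d : ℤ) - 2

/-- The point lies in the cube `[0, side d]³`. -/
def InBox (d : ℕ) (p : Point) : Prop :=
  (0 ≤ p.1 ∧ p.1 ≤ side d) ∧ (0 ≤ p.2.1 ∧ p.2.1 ≤ side d) ∧ (0 ≤ p.2.2 ∧ p.2.2 ≤ side d)

/-- The vertices of the distance-`d` rectified cubic lattice. -/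
noncomputable def siteFinset (d : ℕ) : Finset Point :=
  (Finset.Icc 0 (side d) ×ˢ Finset.Icc 0 (side d) ×ˢ Finset.Icc 0 (side d)).filter IsSite

/-- The vertices of the distance-`d` rectified cubic lattice, as a type. -/
abbrev Vertex (d : ℕ) : Type := {p : Point // p ∈ siteFinset d}

/-- The coordinate along which the two `c`-boundaries are opposite: the `r`-boundaries are left and
right, the `b`-boundaries front and back, the `g`-boundaries bottom and top. -/
def axis : Colour → Point → ℤ
  | .r, p => p.1
  | .b, p => p.2.1
  | .g, p => p.2.2

/-- The vertices on one of the two `c`-boundaries (`s` says which of the two). -/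
def boundary (d : ℕ) (c : Colour) (s : Bool) : Set (Vertex d) :=
  {v | axis c v.1 = if s then side d else 0}

/-- The vertices of the distance-`d` lattice that belong to the cell of colour `c` centred at `p`
(so cells that the boundary cuts are incomplete). -/
def cellSupport (d : ℕ) (c : Colour) (p : Point) : Set (Vertex d) :=
  {v | sqDist v.1 p = sqRadius c}

/-- Centres of the extra boundary cells. On the `b`-boundaries (`y = 0` and `y = side d`) the faces
of the `b`-cuboctahedra are turned into 2D flattenings of `r`-cells: such a face is what the lattice
keeps of the `r`-cuboctahedron centred at distance one beyond the boundary. The same holds on the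
`r`-boundaries with `r` and `b` exchanged. -/
def IsFlattened (d : ℕ) : Colour → Point → Prop
  | .g, _ => False
  | .r, p => (0 ≤ p.1 ∧ p.1 ≤ side d) ∧ (0 ≤ p.2.2 ∧ p.2.2 ≤ side d) ∧
      (p.2.1 = -1 ∨ p.2.1 = side d + 1)
  | .b, p => (0 ≤ p.2.1 ∧ p.2.1 ≤ side d) ∧ (0 ≤ p.2.2 ∧ p.2.2 ≤ side d) ∧
      (p.1 = -1 ∨ p.1 = side d + 1)

/-- `p` is the centre of a `c`-cell of the distance-`d` lattice, 2D flattenings included. -/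
def IsCell (d : ℕ) (c : Colour) (p : Point) : Prop :=
  IsCentre c p ∧ (InBox d p ∨ IsFlattened d c p)

/-- Supports of the `X` stabilizer generators of the code `c`: the `c`-cells. -/
def xSupports (d : ℕ) (c : Colour) : Set (Set (Vertex d)) :=
  {S | ∃ p, IsCell d c p ∧ S = cellSupport d c p}

/-- Supports of the `Z` stabilizer generators of the code `c`: the faces of the two other colours.
A face is what the lattice keeps of the common face of two adjacent cells of the infinite lattice
(centres at squared distance 4 for two cuboctahedra, 3 for a cuboctahedron and an octahedron).
* `rb`-faces: all square faces of the cuboctahedra of the lattice, including those on the boundary,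
  which keep the colour that they have in the infinite lattice;
* `rg`-faces: the common faces of an `r`-cell and a `g`-cell. If the `r`-cell is a 2D flattening,
  this is an edge on a `b`-boundary (a weight-two stabilizer);
* `gb`-faces: the same with `r` and `b` exchanged. -/
def zSupports (d : ℕ) : Colour → Set (Set (Vertex d))
  | .g => {S | S.Nonempty ∧ ∃ p q, IsCentre .r p ∧ IsCentre .b q ∧ (InBox d p ∨ InBox d q) ∧
      sqDist p q = 4 ∧ S = cellSupport d .r p ∩ cellSupport d .b q}
  | .b => {S | ∃ p q, IsCell d .r p ∧ IsCell d .g q ∧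
      sqDist p q = 3 ∧ S = cellSupport d .r p ∩ cellSupport d .g q}
  | .r => {S | ∃ p q, IsCell d .b p ∧ IsCell d .g q ∧
      sqDist p q = 3 ∧ S = cellSupport d .b p ∩ cellSupport d .g q}

/-! ### Qubits and operators -/

/-- Tensor product of the operators `M i` (each on a copy of the space with basis `κ`). -/
def tensorOp {ι κ : Type} [Fintype ι] (M : ι → Matrix κ κ ℂ) : Matrix (ι → κ) (ι → κ) ℂ :=
  Matrix.of fun x y => ∏ i, M i (x i) (y i)

/-- The Pauli matrix `X` on one qubit. -/
def pauliX : Matrix (ZMod 2) (ZMod 2) ℂ := Matrix.of fun i j => if i = j then 0 else 1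

/-- The Pauli matrix `Z` on one qubit. -/
def pauliZ : Matrix (ZMod 2) (ZMod 2) ℂ := Matrix.diagonal fun i => if i = 0 then 1 else -1

/-- The gate `CCZ` on three qubits (one per colour). -/
def ccz : Matrix (Colour → ZMod 2) (Colour → ZMod 2) ℂ :=
  Matrix.diagonal fun a => if ∀ c, a c = 1 then -1 else 1

/-- Labels of the computational basis of the stack: three qubits (one per code) at each vertex. -/
abbrev Config (d : ℕ) : Type := Vertex d → Colour → ZMod 2

/-- The state space of all the physical qubits of the stack. -/
abbrev StackSpace (d : ℕ) : Type := EuclideanSpace ℂ (Config d)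

/-- The state space of the physical qubits of one code (one qubit per vertex). -/
abbrev PhysSpace (d : ℕ) : Type := EuclideanSpace ℂ (Vertex d → ZMod 2)

open Classical in
/-- The operator that applies `P` to the qubits of the code `c` at the vertices in `S`, and the
identity to all the other qubits. -/
noncomputable def applyOn (d : ℕ) (P : Matrix (ZMod 2) (ZMod 2) ℂ) (c : Colour)
    (S : Set (Vertex d)) : StackSpace d →ₗ[ℂ] StackSpace d :=
  Matrix.toEuclideanLin
    (tensorOp fun v : Vertex d => tensorOp fun c' : Colour => if c' = c ∧ v ∈ S then P else 1)

/-- The physical gate: a `CCZ` on the three qubits at every vertex. -/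
noncomputable def transversalCCZ (d : ℕ) : StackSpace d →ₗ[ℂ] StackSpace d :=
  Matrix.toEuclideanLin (tensorOp fun _ : Vertex d => ccz)

/-- The code space of the stack: the joint `+1` eigenspace of all the `X` and `Z` stabilizers of the
three codes. -/
noncomputable def codeSpace (d : ℕ) : Submodule ℂ (StackSpace d) :=
  ⨅ c : Colour,
    (⨅ S ∈ xSupports d c, Module.End.eigenspace (applyOn d pauliX c S) 1) ⊓
    (⨅ S ∈ zSupports d c, Module.End.eigenspace (applyOn d pauliZ c S) 1)

/-! ### Encoded states -/

/-- The binary vector of a set of vertices. -/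
noncomputable def binVec (d : ℕ) (S : Set (Vertex d)) : Vertex d → ZMod 2 := S.indicator 1

/-- The span `G₀` of the binary vectors of the `X` stabilizer generators of the code `c`. -/
noncomputable def xSpan (d : ℕ) (c : Colour) : Submodule (ZMod 2) (Vertex d → ZMod 2) :=
  Submodule.span (ZMod 2) (binVec d '' xSupports d c)

/-- The coset `G_a = a X + G₀`, where `X` is the binary vector of the canonical logical operator `X`
of the code `c`, which acts on all the vertices of one of the `c`-boundaries (the one given by
`s c`). -/
def xCoset (d : ℕ) (s : Colour → Bool) (c : Colour) (a : ZMod 2) : Set (Vertex d → ZMod 2) :=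
  {x | ∃ h ∈ xSpan d c, x = a • binVec d (boundary d c (s c)) + h}

open Classical in
/-- The encoded basis state of the code `c`: the normalized uniform superposition of the elements
of `G_a`. -/
noncomputable def encodedKet (d : ℕ) (s : Colour → Bool) (c : Colour) (a : ZMod 2) :
    PhysSpace d :=
  ((1 / Real.sqrt (Nat.card (xCoset d s c a)) : ℝ) : ℂ) •
    ∑ x : Vertex d → ZMod 2 with x ∈ xCoset d s c a, EuclideanSpace.single x (1 : ℂ)

/-- The encoded basis state of the stack: the tensor product of the encoded basis states
of the three codes. -/
noncomputable def stackKet (d : ℕ) (s : Colour → Bool) (a : Colour → ZMod 2) : StackSpace d :=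
  WithLp.toLp 2 fun x : Config d => ∏ c, encodedKet d s c (a c) fun v => x v c

/-- The number of lattice collisions of three binary vectors (one per code): the number of vertices
at which all three are equal to one. -/
noncomputable def collisions (d : ℕ) (x : Colour → Vertex d → ZMod 2) : ℕ :=
  (Finset.univ.filter fun v : Vertex d => ∀ c, x c v = 1).card

end CCZStack

/-! Two facts carry the theorem: exactness of each code up to one class, and the vanishing of a
trilinear form.

Exactness (`exists_xSpan_add`): a binary vector that passes all `Z` checks of a code is a sum of `X`
stabilizers plus a multiple of a logical boundary. Vectors are extended by zero to the integer grid.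
A closed vector is integrated along lines joining the two logical boundaries, starting at the near
one; the coboundary of this primitive is subtracted. The defect is closed and vanishes at the even
vertices short of the far boundary. The checks then propagate this vanishing to the other vertices,
and on the far boundary they force the defect to be constant (`TriClosed.exists_primitive`,
`SquareClosed.exists_primitive`). Exchanging x and y exchanges the `r` and `b` codes, so only two
geometries have to be studied.

Trilinearity (`triple_coset`): the number of common ones modulo two is trilinear. Overlapping cells
of two different colours meet in a `Z` check of the third code, so each term with at least two
stabilizer slots vanishes. A cell meets the edge of the cube where boundaries of the two other
colours cross in zero or two vertices, so terms with one stabilizer slot vanish. Three boundaries of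
different colours meet in a single corner. What remains is the product of the three labels.

The same form proves that the logical classes are nontrivial: with boundaries in the two other
slots, it reads off the label of a coset (`xCoset_unique`). With exactness, every closed vector
therefore lies in exactly one coset.

On states, `X` stabilizers act as translations and `Z` stabilizers as signs. The code space thus
consists of the functions supported on closed configurations and constant on translates of the
stabilizer spans (`mem_codeSpace`), and the encoded states are normalized indicators of disjoint
products of cosets. The transversal gate multiplies a configuration by minus one to the number of
collisions, which is constant on each such product. -/

namespace CCZStack

/-! ### Cells and triangle checks of the cuboctahedral codes on the grid -/

/-- Points of the box `[0, L]³`. -/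
def Box (L x y z : ℤ) : Prop := 0 ≤ x ∧ x ≤ L ∧ 0 ≤ y ∧ y ≤ L ∧ 0 ≤ z ∧ z ≤ L

instance (L x y z : ℤ) : Decidable (Box L x y z) := by unfold Box; infer_instance

/-- Centres of the cells which carry the `X` stabilizers of a cuboctahedral code whose logical
boundaries are `y = 0` and `y = L`; `e` is the residue modulo `4` of the coordinate sum. -/
def CubCell (e L x y z : ℤ) : Prop :=
  x % 2 = 1 ∧ y % 2 = 1 ∧ z % 2 = 0 ∧ (x + y + z - e) % 4 = 0 ∧
    -1 ≤ x ∧ x ≤ L + 1 ∧ 0 ≤ y ∧ y ≤ L ∧ 0 ≤ z ∧ z ≤ L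

instance (e L x y z : ℤ) : Decidable (CubCell e L x y z) := by unfold CubCell; infer_instance

/-- Centres of the cells of the opposite cuboctahedral colour. -/
def OppCell (e L x y z : ℤ) : Prop :=
  x % 2 = 1 ∧ y % 2 = 1 ∧ z % 2 = 0 ∧ (x + y + z - e) % 4 = 2 ∧
    0 ≤ x ∧ x ≤ L ∧ -1 ≤ y ∧ y ≤ L + 1 ∧ 0 ≤ z ∧ z ≤ L

/-- The triangle conditions: the `Z` checks of a cuboctahedral code. -/
def TriClosed (e L : ℤ) (W : ℤ → ℤ → ℤ → ZMod 2) : Prop :=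
  ∀ x y z a b c : ℤ, OppCell e L x y z → (a = 1 ∨ a = -1) → (b = 1 ∨ b = -1) →
    (c = 1 ∨ c = -1) → Box L (x + a) (y + b) (z + c) →
    W x (y + b) (z + c) + W (x + a) y (z + c) + W (x + a) (y + b) z = 0

/-- The coboundary of a function on the cuboctahedra, at a vertex of the lattice. -/
def cubNbr (f : ℤ → ℤ → ℤ → ZMod 2) (x y z : ℤ) : ZMod 2 :=
  -- Positions of both cuboctahedral colours are listed; the support condition on `f` imposed later
  -- keeps only those of the code's own colour.
  if z % 2 = 0 then f (x + 1) (y + 1) z + f (x + 1) (y - 1) z + f (x - 1) (y + 1) z +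
    f (x - 1) (y - 1) z
  else if x % 2 = 1 then f x (y + 1) (z + 1) + f x (y + 1) (z - 1) + f x (y - 1) (z + 1) +
    f x (y - 1) (z - 1)
  else f (x + 1) y (z + 1) + f (x + 1) y (z - 1) + f (x - 1) y (z + 1) + f (x - 1) y (z - 1)

theorem two_eq_zero_zmod : (2 : ZMod 2) = 0 := rfl

/-- The cells of the code that meet the triangle are the neighbours of the opposite cell shifted by
2 along one axis. Each contains two of the three vertices, so it is counted twice. If the middle
vertex lies beyond a y-boundary, so do the two cells through it, and `f` vanishes there. -/
theorem triClosed_cubNbr {e L : ℤ} {f : ℤ → ℤ → ℤ → ZMod 2} (hL : L % 2 = 0)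
    (hf : ∀ x y z, ¬ CubCell e L x y z → f x y z = 0) :
    TriClosed e L fun x y z => if Box L x y z then cubNbr f x y z else 0 := by
  intro x y z a b c ⟨hx, hy, hz, he, h1, h2, h3, h4, h5, h6⟩ ha hb hc hbox
  have h2' := two_eq_zero_zmod
  simp only [Box] at hbox
  -- The centre of the opposite cell and its shifts by 2 along two axes have the wrong residue
  -- modulo 4.
  have z1 : f x y z = 0 := hf _ _ _ (by simp only [CubCell]; omega)
  have z2 : f x (y + 2 * b) (z + 2 * c) = 0 := hf _ _ _ (by simp only [CubCell]; omega)
  have z3 : f (x + 2 * a) y (z + 2 * c) = 0 := hf _ _ _ (by simp only [CubCell]; omega)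
  have z4 : f (x + 2 * a) (y + 2 * b) z = 0 := hf _ _ _ (by simp only [CubCell]; omega)
  have e1 : cubNbr f x (y + b) (z + c) = f x (y + 2 * b) z + f x y (z + 2 * c) := by
    rw [cubNbr, if_neg (by omega), if_pos (by omega)]
    rcases hb with rfl | rfl <;> rcases hc with rfl | rfl <;> ring_nf at * <;> simp [*]
  have e2 : cubNbr f (x + a) y (z + c) = f (x + 2 * a) y z + f x y (z + 2 * c) := by
    rw [cubNbr, if_neg (by omega), if_neg (by omega)]
    rcases ha with rfl | rfl <;> rcases hc with rfl | rfl <;> ring_nf at * <;> simp [*]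
  have e3 : cubNbr f (x + a) (y + b) z = f (x + 2 * a) y z + f x (y + 2 * b) z := by
    rw [cubNbr, if_pos (by omega)]
    rcases ha with rfl | rfl <;> rcases hb with rfl | rfl <;> ring_nf at * <;> simp [*]
  have hA : Box L x (y + b) (z + c) := by simp only [Box]; omega
  have hC : Box L (x + a) (y + b) z := by simp only [Box]; omega
  simp only [e1, e2, e3, hA, hC, if_true]
  by_cases h : Box L (x + a) y (z + c)
  · rw [if_pos h]
    linear_combination (f x (y + 2 * b) z + f x y (z + 2 * c) + f (x + 2 * a) y z) * h2'
  · rw [if_neg h]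
    simp only [Box] at h
    have z5 : f x y (z + 2 * c) = 0 := hf _ _ _ (by simp only [CubCell]; omega)
    have z6 : f (x + 2 * a) y z = 0 := hf _ _ _ (by simp only [CubCell]; omega)
    linear_combination z5 + z6 + f x (y + 2 * b) z * h2'

/-- Two vertices of the triangle share the even coordinate `y + b`, and the third has the odd
coordinate `y`, so zero or two of them lie on the boundary. -/
theorem triClosed_boundary {e L t : ℤ} (hL : L % 2 = 0) (ht : t = 0 ∨ t = L) :
    TriClosed e L fun x y z => if Box L x y z then if y = t then 1 else 0 else 0 := by
  intro x y z a b c ⟨hx, hy, hz, he, h1, h2, h3, h4, h5, h6⟩ ha hb hc hbox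
  simp only [Box] at hbox
  have hy' : ¬ y = t := by omega
  have hA : Box L x (y + b) (z + c) := by simp only [Box]; omega
  have hC : Box L (x + a) (y + b) z := by simp only [Box]; omega
  simp only [hy', hA, hC, if_true, if_false, ite_self]
  split_ifs <;> rfl

theorem TriClosed.add {e L : ℤ} {W W' : ℤ → ℤ → ℤ → ZMod 2} (h : TriClosed e L W)
    (h' : TriClosed e L W') : TriClosed e L fun x y z => W x y z + W' x y z := by
  intro x y z a b c h0 ha hb hc hbox
  linear_combination h x y z a b c h0 ha hb hc hbox + h' x y z a b c h0 ha hb hc hbox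

theorem TriClosed.congr {e L : ℤ} {W W' : ℤ → ℤ → ℤ → ZMod 2} (h : TriClosed e L W)
    (h' : ∀ x y z, (z % 2 = 0 ∧ x % 2 = 0 ∧ y % 2 = 0 ∨ z % 2 = 1 ∧ (x + y) % 2 = 1) →
      W' x y z = W x y z) : TriClosed e L W' := by
  intro x y z a b c h0 ha hb hc hbox
  obtain ⟨hx, hy, hz, -⟩ := id h0
  rw [h' _ _ _ (by omega), h' _ _ _ (by omega), h' _ _ _ (by omega)]
  exact h x y z a b c h0 ha hb hc hbox

/-! ### Exactness for the cuboctahedral codes -/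

section Cocycle

variable {e L : ℤ} {W : ℤ → ℤ → ℤ → ZMod 2}

/-- Adding the triangles `a = 1` and `a = -1` with the same `b`, `c` cancels their common vertex and
expresses one side of the square through two diamond vertices that do not depend on `b`. The two
sides therefore have equal sums. -/
theorem TriClosed.square (hW : TriClosed e L W) (h0 : ∀ x y z, ¬ Box L x y z → W x y z = 0)
    (hL : L % 2 = 0) (hL2 : 2 ≤ L) {x y z : ℤ} (h : OppCell e L x y z) :
    W (x - 1) (y + 1) z + W (x + 1) (y + 1) z + W (x - 1) (y - 1) z + W (x + 1) (y - 1) z = 0 := by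
  have ⟨hx, hy, hz, he, h1, h2, h3, h4, h5, h6⟩ := h
  have t2 := two_eq_zero_zmod
  obtain ⟨c, hc, hzc⟩ : ∃ c : ℤ, (c = 1 ∨ c = -1) ∧ 0 ≤ z + c ∧ z + c ≤ L := by
    by_cases h : z < L
    · exact ⟨1, by omega⟩
    · exact ⟨-1, by omega⟩
  have row : ∀ b : ℤ, (b = 1 ∨ b = -1) →
      W (x - 1) (y + b) z + W (x + 1) (y + b) z = W (x - 1) y (z + c) + W (x + 1) y (z + c) ∨
      (W (x - 1) (y + b) z = 0 ∧ W (x + 1) (y + b) z = 0 ∧ W (x - 1) y (z + c) = 0 ∧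
        W (x + 1) y (z + c) = 0) := by
    intro b hb
    by_cases hyb : 0 ≤ y + b ∧ y + b ≤ L
    · left
      have a1 := hW x y z 1 b c h (by simp) hb hc (by simp only [Box]; omega)
      have a2 := hW x y z (-1) b c h (by simp) hb hc (by simp only [Box]; omega)
      rw [← sub_eq_add_neg] at a2
      linear_combination a1 + a2 - (W x (y + b) (z + c) + W (x - 1) y (z + c) +
        W (x + 1) y (z + c)) * t2
    -- Here `y` is `-1` or `L + 1`, so the points at height `y` are outside the box as well as the
    -- side `y + b`.
    · right
      refine ⟨?_, ?_, ?_, ?_⟩ <;> apply h0 <;> simp only [Box] <;> omega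
  have r1 := row 1 (by simp)
  have r2 := row (-1) (by simp)
  rw [← sub_eq_add_neg] at r2
  have g1 : W (x - 1) (y + 1) z + W (x + 1) (y + 1) z =
      W (x - 1) y (z + c) + W (x + 1) y (z + c) := by
    rcases r1 with r | ⟨p, q, r, s⟩
    · exact r
    · simp [p, q, r, s]
  have g2 : W (x - 1) (y - 1) z + W (x + 1) (y - 1) z =
      W (x - 1) y (z + c) + W (x + 1) y (z + c) := by
    rcases r2 with r | ⟨p, q, r, s⟩
    · exact r
    · simp [p, q, r, s]
  linear_combination g1 + g2 + (W (x - 1) y (z + c) + W (x + 1) y (z + c)) * t2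

/-- The sum of `W` along a column parallel to the `y`-axis. -/
def columnSum (W : ℤ → ℤ → ℤ → ZMod 2) (x z : ℤ) (n : ℕ) : ZMod 2 :=
  ∑ i ∈ Finset.range n, W x (2 * i) z

theorem columnSum_succ (x z : ℤ) (n : ℕ) :
    columnSum W x z (n + 1) = columnSum W x z n + W x (2 * n) z := by
  simp [columnSum, Finset.sum_range_succ]

/-- Below a cell of the code, the strip between the two columns is tiled by squares around opposite
cells, each covering two successive heights; hence the induction in steps of two. For odd `n` the
lowest square is centred at `y = -1` and only its upper side lies in the box. -/
theorem columnSum_eq (hW : TriClosed e L W) (h0 : ∀ x y z, ¬ Box L x y z → W x y z = 0)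
    (hL : L % 2 = 0) (hL2 : 2 ≤ L) {x z : ℤ} (hx : x % 2 = 1) (hx0 : 0 ≤ x) (hxL : x ≤ L)
    (hz : z % 2 = 0) (hz0 : 0 ≤ z) (hzL : z ≤ L) (n : ℕ) (hn : 2 * (n : ℤ) ≤ L)
    (hr : (x + (2 * n - 1) + z - e) % 4 = 0) :
    columnSum W (x - 1) z n = columnSum W (x + 1) z n := by
  have t2 := two_eq_zero_zmod
  induction n using Nat.strong_induction_on with
  | _ n ih =>
    match n, hr, hn, ih with
    | 0, _, _, _ => simp [columnSum]
    | 1, hr, hn, _ =>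
      have s := hW.square h0 hL hL2 (x := x) (y := -1) (z := z)
        ⟨hx, by omega, hz, by push_cast at hr; omega, by omega, by omega, by omega, by omega,
          hz0, hzL⟩
      have o1 : W (x - 1) (-1 - 1) z = 0 := h0 _ _ _ (by simp only [Box]; omega)
      have o2 : W (x + 1) (-1 - 1) z = 0 := h0 _ _ _ (by simp only [Box]; omega)
      simp only [o1, o2, neg_add_cancel] at s
      simp only [columnSum, Finset.sum_range_one, Nat.cast_zero, mul_zero]
      linear_combination s - W (x + 1) 0 z * t2
    | n + 2, hr, hn, ih =>
      push_cast at hr hn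
      have i := ih n (by omega) (by omega) (by omega)
      have s := hW.square h0 hL hL2 (x := x) (y := 2 * n + 1) (z := z)
        ⟨hx, by omega, hz, by omega, by omega, by omega, by omega, by omega, hz0, hzL⟩
      simp only [columnSum_succ]
      have q1 : (2 * ((n + 1 : ℕ) : ℤ)) = 2 * n + 1 + 1 := by push_cast; ring
      rw [q1]
      rw [add_sub_cancel_right] at s
      linear_combination i + s - (W (x + 1) (2 * n + 1 + 1) z + W (x + 1) (2 * n) z) * t2

open Classical in
/-- A primitive of a closed `W`, normalized to vanish on the boundary `y = 0`. -/
noncomputable def cubPrim (e L : ℤ) (W : ℤ → ℤ → ℤ → ZMod 2) (x y z : ℤ) : ZMod 2 :=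
  if CubCell e L x y z then
    columnSum W (if x < L then x + 1 else x - 1) z ((y + 1) / 2).toNat
  else 0

/-- The primitive does not depend on the column chosen in its definition: if both columns lie in the
box, `columnSum_eq` identifies them. -/
theorem cubPrim_eq (hW : TriClosed e L W) (h0 : ∀ x y z, ¬ Box L x y z → W x y z = 0)
    (hL : L % 2 = 0) (hL2 : 2 ≤ L) {x x' y z : ℤ} (h : CubCell e L x y z)
    (hx' : x' = x + 1 ∨ x' = x - 1) (h0x : 0 ≤ x') (hLx : x' ≤ L) (n : ℕ) (hn : y = 2 * n - 1) :
    cubPrim e L W x y z = columnSum W x' z n := by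
  have ⟨hx, hy, hz, he, h1, h2, h3, h4, h5, h6⟩ := h
  have hn' : ((y + 1) / 2).toNat = n := by omega
  rw [cubPrim, if_pos h, hn']
  rcases hx' with rfl | rfl
  · rw [if_pos (by omega)]
  · split_ifs with hlt
    · rw [columnSum_eq hW h0 hL hL2 hx (by omega) (by omega) hz h5 h6 n (by omega)]
      subst hn; exact he
    · rfl

/-- The difference between `W` and the coboundary of its primitive. -/
noncomputable def cubDefect (e L : ℤ) (W : ℤ → ℤ → ℤ → ZMod 2) (x y z : ℤ) : ZMod 2 :=
  W x y z + if Box L x y z then cubNbr (cubPrim e L W) x y z else 0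

theorem cubPrim_support (x y z : ℤ) (h : ¬ CubCell e L x y z) : cubPrim e L W x y z = 0 :=
  if_neg h

theorem cubDefect_triClosed (hW : TriClosed e L W) (hL : L % 2 = 0) :
    TriClosed e L (cubDefect e L W) :=
  hW.add (triClosed_cubNbr hL cubPrim_support)

theorem cubDefect_out (h0 : ∀ x y z, ¬ Box L x y z → W x y z = 0) (x y z : ℤ)
    (h : ¬ Box L x y z) : cubDefect e L W x y z = 0 := by
  simp [cubDefect, h0 x y z h, h]

/-- Two of the four diagonal positions have the residue of the code, one below and one above the
vertex in y. Evaluated in the vertex's own column, their primitives differ by the value of `W` at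
the vertex. The flattened cells supply these positions at `x = 0` and `x = L`. -/
theorem cubDefect_even (hW : TriClosed e L W) (h0 : ∀ x y z, ¬ Box L x y z → W x y z = 0)
    (hL : L % 2 = 0) (hL2 : 2 ≤ L) (he : e % 2 = 0) {x y z : ℤ} (hx : x % 2 = 0) (hy : y % 2 = 0)
    (hz : z % 2 = 0) (hy' : y ≠ L) : cubDefect e L W x y z = 0 := by
  by_cases hb : Box L x y z
  swap
  · exact cubDefect_out h0 x y z hb
  have t2 := two_eq_zero_zmod
  have ⟨h1, h2, h3, h4, h5, h6⟩ := hb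
  rw [cubDefect, if_pos hb, cubNbr, if_pos hz]
  obtain ⟨n, hn⟩ : ∃ n : ℕ, y = 2 * n := ⟨(y / 2).toNat, by omega⟩
  have low : ∀ x', (x' = x + 1 ∨ x' = x - 1) → (x' + (y - 1) + z - e) % 4 = 0 →
      cubPrim e L W x' (y - 1) z = columnSum W x z n := by
    intro x' hx' hr
    by_cases hc : CubCell e L x' (y - 1) z
    · exact cubPrim_eq hW h0 hL hL2 hc (by omega) h1 h2 n (by omega)
    -- The lower position fails to be a cell only at `y = 0`, where the column sum is empty.
    · rw [cubPrim_support _ _ _ hc]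
      simp only [CubCell] at hc
      have : n = 0 := by omega
      simp [this, columnSum]
  have high : ∀ x', (x' = x + 1 ∨ x' = x - 1) → (x' + (y + 1) + z - e) % 4 = 0 →
      cubPrim e L W x' (y + 1) z = columnSum W x z n + W x y z := by
    intro x' hx' hr
    rw [cubPrim_eq hW h0 hL hL2 (x' := x) (by simp only [CubCell]; omega) (by omega) h1 h2 (n + 1)
      (by push_cast; omega), columnSum_succ, hn]
  have off : ∀ x' y', (x' + y' + z - e) % 4 = 2 → cubPrim e L W x' y' z = 0 := by
    intro x' y' h
    apply cubPrim_support
    simp only [CubCell]; omega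
  rcases (by omega : (x + y + z - e) % 4 = 0 ∨ (x + y + z - e) % 4 = 2) with hr | hr
  · rw [off (x + 1) (y + 1) (by omega), off (x - 1) (y - 1) (by omega),
      low (x + 1) (by omega) (by omega), high (x - 1) (by omega) (by omega)]
    linear_combination (W x y z + columnSum W x z n) * t2
  · rw [off (x + 1) (y - 1) (by omega), off (x - 1) (y + 1) (by omega),
      low (x - 1) (by omega) (by omega), high (x + 1) (by omega) (by omega)]
    linear_combination (W x y z + columnSum W x z n) * t2

/-- Induction on the height in y: a diamond vertex is completed to a triangle by an even vertex,
where `W` is already zero, and a diamond vertex one step lower. At height 0 the lower vertex is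
outside the box, which is the weight-two check of a flattened cell. -/
theorem layer_eq_zero (hW : TriClosed e L W) (h0 : ∀ x y z, ¬ Box L x y z → W x y z = 0)
    (hL : L % 2 = 0) (hL2 : 2 ≤ L) (he : e % 2 = 0)
    (hE : ∀ x y z : ℤ, x % 2 = 0 → y % 2 = 0 → z % 2 = 0 → y ≠ L → W x y z = 0)
    (n : ℕ) : ∀ x z : ℤ, z % 2 = 1 → (x + n) % 2 = 1 → (n : ℤ) ≠ L → W x n z = 0 := by
  induction n with
  | zero =>
    intro x z hz hx _
    by_cases hb : Box L x (0 : ℕ) z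
    swap
    · exact h0 _ _ _ hb
    simp only [Box] at hb
    push_cast at hx hb ⊢
    -- The two candidate centres differ by 2 in z, so exactly one has the residue of the opposite
    -- colour.
    obtain ⟨c, hc, hr⟩ : ∃ c : ℤ, (c = 1 ∨ c = -1) ∧ (x + (-1) + (z - c) - e) % 4 = 2 := by
      rcases (by omega : (x + (-1) + (z - 1) - e) % 4 = 2 ∨ (x + (-1) + (z + 1) - e) % 4 = 2)
        with h | h
      · exact ⟨1, by omega⟩
      · exact ⟨-1, by omega⟩
    have t := hW x (-1) (z - c) 1 1 c (by simp only [OppCell]; omega) (by simp) (by simp) hc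
      (by simp only [Box]; omega)
    rw [h0 (x + 1) (-1) _ (by simp only [Box]; omega),
      hE (x + 1) (-1 + 1) (z - c) (by omega) (by omega) (by omega) (by omega)] at t
    simpa using t
  | succ n ih =>
    intro x z hz hx hn
    by_cases hb : Box L x (n + 1 : ℕ) z
    swap
    · exact h0 _ _ _ hb
    simp only [Box] at hb
    push_cast at hx hb hn ⊢
    rcases (by omega : (n : ℤ) % 2 = 1 ∨ (n : ℤ) % 2 = 0) with hpar | hpar
    · obtain ⟨c, hc, hr⟩ : ∃ c : ℤ, (c = 1 ∨ c = -1) ∧ (x + n + (z - c) - e) % 4 = 2 := by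
        rcases (by omega : (x + n + (z - 1) - e) % 4 = 2 ∨ (x + n + (z + 1) - e) % 4 = 2)
          with h | h
        · exact ⟨1, by omega⟩
        · exact ⟨-1, by omega⟩
      have t := hW x n (z - c) 1 1 c (by simp only [OppCell]; omega) (by simp) (by simp) hc
        (by simp only [Box]; omega)
      rw [hE (x + 1) (n + 1) _ (by omega) (by omega) (by omega) (by omega), sub_add_cancel,
        ih (x + 1) z hz (by omega) (by omega)] at t
      simpa using t
    -- At an odd height the centre is displaced in x from the vertex, and the sign `a` must keep it
    -- inside the box.
    · obtain ⟨a, ha, hxa⟩ : ∃ a : ℤ, (a = 1 ∨ a = -1) ∧ 0 ≤ x - a ∧ x - a ≤ L := by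
        by_cases h : x < L
        · exact ⟨-1, by omega⟩
        · exact ⟨1, by omega⟩
      obtain ⟨c, hc, hr⟩ : ∃ c : ℤ, (c = 1 ∨ c = -1) ∧
          ((x - a) + (n + 1) + (z - c) - e) % 4 = 2 := by
        rcases (by omega : ((x - a) + (n + 1) + (z - 1) - e) % 4 = 2 ∨
          ((x - a) + (n + 1) + (z + 1) - e) % 4 = 2) with h | h
        · exact ⟨1, by omega⟩
        · exact ⟨-1, by omega⟩
      have t := hW (x - a) (n + 1) (z - c) a (-1) c (by simp only [OppCell]; omega) ha (by simp) hc
        (by simp only [Box]; omega)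
      rw [add_neg_cancel_right, sub_add_cancel, sub_add_cancel,
        hE x n _ (by omega) hpar (by omega) (by omega),
        ih (x - a) z hz (by omega) (by omega)] at t
      simpa using t

/-- The middle vertex of the triangle is off the plane `y = L`, so its value is zero and the two
vertices on that plane agree. The residue dictates `b`; when `b = -1` the triangle comes from a
flattened cell at `y = L + 1`. -/
theorem top_move (hW : TriClosed e L W)
    (hL : L % 2 = 0) (he : e % 2 = 0)
    (hB : ∀ x y z : ℤ, z % 2 = 1 → (x + y) % 2 = 1 → y ≠ L → W x y z = 0)
    {x z a c : ℤ} (hx : x % 2 = 1) (hx0 : 0 ≤ x) (hxL : x ≤ L) (hz : z % 2 = 1) (hz0 : 0 ≤ z)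
    (hzL : z ≤ L) (ha : a = 1 ∨ a = -1) (hc : c = 1 ∨ c = -1) :
    W (x + a) L (z - c) = W x L z := by
  have t2 := two_eq_zero_zmod
  obtain ⟨b, hb, hr⟩ : ∃ b : ℤ, (b = 1 ∨ b = -1) ∧ (x + (L - b) + (z - c) - e) % 4 = 2 := by
    rcases (by omega : (x + (L - 1) + (z - c) - e) % 4 = 2 ∨ (x + (L + 1) + (z - c) - e) % 4 = 2)
      with h | h
    · exact ⟨1, by omega⟩
    · exact ⟨-1, by omega⟩
  have t := hW x (L - b) (z - c) a b c (by simp only [OppCell]; omega) ha hb hc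
    (by simp only [Box]; omega)
  rw [sub_add_cancel, sub_add_cancel, hB (x + a) (L - b) z hz (by omega) (by omega)] at t
  linear_combination t - W x L z * t2

/-- Two moves through a common diamond vertex shift an even vertex by 2 in z or in x, and one move
joins a diamond vertex to an even one; hence the whole boundary is connected. -/
theorem top_const (hW : TriClosed e L W) (hL : L % 2 = 0) (he : e % 2 = 0)
    (hB : ∀ x y z : ℤ, z % 2 = 1 → (x + y) % 2 = 1 → y ≠ L → W x y z = 0)
    {x z : ℤ} (hx : (x + z) % 2 = 0) (hx0 : 0 ≤ x) (hxL : x ≤ L) (hz0 : 0 ≤ z)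
    (hzL : z ≤ L) : W x L z = W 0 L 0 := by
  have mv := @top_move e L W hW hL he hB
  have zdir : ∀ k : ℕ, 2 * (k : ℤ) ≤ L → W 0 L (2 * k) = W 0 L 0 := by
    intro k
    induction k with
    | zero => simp
    | succ k ih =>
      intro hk
      push_cast at hk ⊢
      have m1 := mv (x := 1) (z := 2 * k + 1) (a := -1) (c := 1) (by omega) (by omega) (by omega)
        (by omega) (by omega) (by omega) (by simp) (by simp)
      have m2 := mv (x := 1) (z := 2 * k + 1) (a := -1) (c := -1) (by omega) (by omega) (by omega)
        (by omega) (by omega) (by omega) (by simp) (by simp)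
      rw [show (2 * (k + 1) : ℤ) = 2 * k + 1 - -1 by ring, ← ih (by omega)]
      rw [show (2 * k + 1 - 1 : ℤ) = 2 * k by ring] at m1
      simp only [add_neg_cancel] at m1 m2
      rw [m1, m2]
  have xdir : ∀ m : ℕ, 2 * (m : ℤ) ≤ L → ∀ z : ℤ, z % 2 = 0 → 0 ≤ z → z ≤ L →
      W (2 * m) L z = W 0 L z := by
    intro m
    induction m with
    | zero => simp
    | succ m ih =>
      intro hm z hz hz0 hzL
      push_cast at hm ⊢
      obtain ⟨c, hc, hzc⟩ : ∃ c : ℤ, (c = 1 ∨ c = -1) ∧ 0 ≤ z + c ∧ z + c ≤ L := by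
        by_cases h : z < L
        · exact ⟨1, by omega⟩
        · exact ⟨-1, by omega⟩
      have m1 := mv (x := 2 * m + 1) (z := z + c) (a := -1) (c := c) (by omega) (by omega)
        (by omega) (by omega) (by omega) (by omega) (by simp) hc
      have m2 := mv (x := 2 * m + 1) (z := z + c) (a := 1) (c := c) (by omega) (by omega)
        (by omega) (by omega) (by omega) (by omega) (by simp) hc
      rw [show (2 * (m + 1) : ℤ) = 2 * m + 1 + 1 by ring, ← ih (by omega) z hz hz0 hzL]
      rw [add_neg_cancel_right, add_sub_cancel_right] at m1
      rw [add_sub_cancel_right] at m2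
      rw [m1, m2]
  have ev : ∀ x z : ℤ, x % 2 = 0 → z % 2 = 0 → 0 ≤ x → x ≤ L → 0 ≤ z → z ≤ L →
      W x L z = W 0 L 0 := by
    intro x z hx hz hx0 hxL hz0 hzL
    have a1 := xdir (x / 2).toNat (by omega) z hz hz0 hzL
    have a2 := zdir (z / 2).toNat (by omega)
    rw [show 2 * (((x / 2).toNat : ℕ) : ℤ) = x by omega] at a1
    rw [show 2 * (((z / 2).toNat : ℕ) : ℤ) = z by omega] at a2
    rw [a1, a2]
  rcases (by omega : x % 2 = 0 ∨ x % 2 = 1) with h | h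
  · exact ev x z h (by omega) hx0 hxL hz0 hzL
  · rw [← mv (x := x) (z := z) (a := 1) (c := 1) h hx0 hxL (by omega) hz0 hzL (by simp) (by simp)]
    exact ev _ _ (by omega) (by omega) (by omega) (by omega) (by omega) (by omega)

/-- A closed function on a cuboctahedral code is a coboundary up to a multiple of the boundary
`y = L`. -/
theorem TriClosed.exists_primitive (hW : TriClosed e L W)
    (h0 : ∀ x y z, ¬ Box L x y z → W x y z = 0)
    (hL : L % 2 = 0) (hL2 : 2 ≤ L) (he : e % 2 = 0) :
    ∃ (f : ℤ → ℤ → ℤ → ZMod 2) (a : ZMod 2), (∀ x y z, ¬ CubCell e L x y z → f x y z = 0) ∧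
      ∀ x y z, Box L x y z →
        (z % 2 = 0 ∧ x % 2 = 0 ∧ y % 2 = 0 ∨ z % 2 = 1 ∧ (x + y) % 2 = 1) →
        W x y z = cubNbr f x y z + if y = L then a else 0 := by
  have t2 := two_eq_zero_zmod
  have hD := cubDefect_triClosed hW hL
  have hD0 := cubDefect_out (e := e) h0
  have hE := fun (x y z : ℤ) => @cubDefect_even e L W hW h0 hL hL2 he x y z
  have hB : ∀ x y z : ℤ, z % 2 = 1 → (x + y) % 2 = 1 → y ≠ L → cubDefect e L W x y z = 0 := by
    intro x y z hz hx hy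
    by_cases hb : Box L x y z
    · have := layer_eq_zero hD hD0 hL hL2 he hE y.toNat x z hz
      rw [Int.toNat_of_nonneg hb.2.2.1] at this
      exact this hx hy
    · exact hD0 _ _ _ hb
  -- The coefficient of the boundary is the constant value of the defect on `y = L`.
  refine ⟨cubPrim e L W, cubDefect e L W 0 L 0, cubPrim_support, ?_⟩
  intro x y z hb hs
  have key : cubDefect e L W x y z = if y = L then cubDefect e L W 0 L 0 else 0 := by
    have hb' := hb
    simp only [Box] at hb'
    split_ifs with hy
    · subst hy
      exact top_const hD hL he hB (by omega) (by omega) (by omega) (by omega) (by omega)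
    · rcases hs with ⟨h1, h2, h3⟩ | ⟨h1, h2⟩
      · exact hE _ _ _ h2 h3 h1 hy
      · exact hB _ _ _ h1 h2 hy
  rw [← key, cubDefect, if_pos hb]
  linear_combination - cubNbr (cubPrim e L W) x y z * t2

end Cocycle

/-! ### Cells and square checks of the octahedral code on the grid -/

/-- Centres of the octahedra of the lattice. -/
def OctCell (L x y z : ℤ) : Prop := x % 2 = 0 ∧ y % 2 = 0 ∧ z % 2 = 1 ∧ Box L x y z

instance (L x y z : ℤ) : Decidable (OctCell L x y z) := by unfold OctCell; infer_instance

/-- The coboundary of a function on the octahedra, at a vertex of the lattice. -/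
def octNbr (f : ℤ → ℤ → ℤ → ZMod 2) (x y z : ℤ) : ZMod 2 :=
  if z % 2 = 0 then f x y (z + 1) + f x y (z - 1)
  else if x % 2 = 1 then f (x + 1) y z + f (x - 1) y z
  else f x (y + 1) z + f x (y - 1) z

/-- The square conditions: the `Z` checks of the octahedral code, by the position of the centre of
the square face. -/
structure SquareClosed (L : ℤ) (W : ℤ → ℤ → ℤ → ZMod 2) : Prop where
  xz : ∀ x y z, x % 2 = 1 → y % 2 = 0 → z % 2 = 0 → Box L x y z →
    W (x + 1) y z + W (x - 1) y z + W x y (z + 1) + W x y (z - 1) = 0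
  yz : ∀ x y z, x % 2 = 0 → y % 2 = 1 → z % 2 = 0 → Box L x y z →
    W x (y + 1) z + W x (y - 1) z + W x y (z + 1) + W x y (z - 1) = 0
  xy : ∀ x y z, x % 2 = 1 → y % 2 = 1 → z % 2 = 1 → Box L x y z →
    W (x + 1) y z + W (x - 1) y z + W x (y + 1) z + W x (y - 1) z = 0

/-- Each octahedron that meets the square contains an edge of it, so it is counted twice. When the
face is cut at `z = 0` or `z = L`, the octahedra through the missing vertex are missing too. -/
theorem squareClosed_octNbr {L : ℤ} {f : ℤ → ℤ → ℤ → ZMod 2} (hL : L % 2 = 0)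
    (hf : ∀ x y z, ¬ OctCell L x y z → f x y z = 0) :
    SquareClosed L fun x y z => if Box L x y z then octNbr f x y z else 0 := by
  have t2 := two_eq_zero_zmod
  have drop : ∀ x y z, (¬ Box L x y z → octNbr f x y z = 0) →
      (if Box L x y z then octNbr f x y z else 0) = octNbr f x y z := by
    intro x y z h
    split_ifs with hb
    · rfl
    · exact (h hb).symm
  refine ⟨?_, ?_, ?_⟩ <;> intro x y z hx hy hz hb <;> simp only [Box] at hb
  · have c1 : octNbr f (x + 1) y z = f (x + 1) y (z + 1) + f (x + 1) y (z - 1) := by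
      rw [octNbr, if_pos hz]
    have c2 : octNbr f (x - 1) y z = f (x - 1) y (z + 1) + f (x - 1) y (z - 1) := by
      rw [octNbr, if_pos hz]
    have c3 : octNbr f x y (z + 1) = f (x + 1) y (z + 1) + f (x - 1) y (z + 1) := by
      rw [octNbr, if_neg (by omega), if_pos hx]
    have c4 : octNbr f x y (z - 1) = f (x + 1) y (z - 1) + f (x - 1) y (z - 1) := by
      rw [octNbr, if_neg (by omega), if_pos hx]
    rw [drop, drop, drop, drop]
    · rw [c1, c2, c3, c4]
      linear_combination (f (x + 1) y (z + 1) + f (x + 1) y (z - 1) + f (x - 1) y (z + 1) +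
        f (x - 1) y (z - 1)) * t2
    all_goals
      intro h
      simp only [Box] at h
      first
      | (exfalso; omega)
      | (simp only [c3, c4]
         rw [hf _ _ _ (by simp only [OctCell, Box]; omega),
           hf _ _ _ (by simp only [OctCell, Box]; omega), add_zero])
  · have c1 : octNbr f x (y + 1) z = f x (y + 1) (z + 1) + f x (y + 1) (z - 1) := by
      rw [octNbr, if_pos hz]
    have c2 : octNbr f x (y - 1) z = f x (y - 1) (z + 1) + f x (y - 1) (z - 1) := by
      rw [octNbr, if_pos hz]
    have c3 : octNbr f x y (z + 1) = f x (y + 1) (z + 1) + f x (y - 1) (z + 1) := by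
      rw [octNbr, if_neg (by omega), if_neg (by omega)]
    have c4 : octNbr f x y (z - 1) = f x (y + 1) (z - 1) + f x (y - 1) (z - 1) := by
      rw [octNbr, if_neg (by omega), if_neg (by omega)]
    rw [drop, drop, drop, drop]
    · rw [c1, c2, c3, c4]
      linear_combination (f x (y + 1) (z + 1) + f x (y + 1) (z - 1) + f x (y - 1) (z + 1) +
        f x (y - 1) (z - 1)) * t2
    all_goals
      intro h
      simp only [Box] at h
      first
      | (exfalso; omega)
      | (simp only [c3, c4]
         rw [hf _ _ _ (by simp only [OctCell, Box]; omega),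
           hf _ _ _ (by simp only [OctCell, Box]; omega), add_zero])
  · have c1 : octNbr f (x + 1) y z = f (x + 1) (y + 1) z + f (x + 1) (y - 1) z := by
      rw [octNbr, if_neg (by omega), if_neg (by omega)]
    have c2 : octNbr f (x - 1) y z = f (x - 1) (y + 1) z + f (x - 1) (y - 1) z := by
      rw [octNbr, if_neg (by omega), if_neg (by omega)]
    have c3 : octNbr f x (y + 1) z = f (x + 1) (y + 1) z + f (x - 1) (y + 1) z := by
      rw [octNbr, if_neg (by omega), if_pos hx]
    have c4 : octNbr f x (y - 1) z = f (x + 1) (y - 1) z + f (x - 1) (y - 1) z := by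
      rw [octNbr, if_neg (by omega), if_pos hx]
    rw [drop, drop, drop, drop]
    · rw [c1, c2, c3, c4]
      linear_combination (f (x + 1) (y + 1) z + f (x + 1) (y - 1) z + f (x - 1) (y + 1) z +
        f (x - 1) (y - 1) z) * t2
    all_goals
      intro h
      simp only [Box] at h
      exfalso; omega

theorem squareClosed_boundary {L t : ℤ} (hL : L % 2 = 0) (ht : t = 0 ∨ t = L) :
    SquareClosed L fun x y z => if Box L x y z then if z = t then 1 else 0 else 0 := by
  refine ⟨?_, ?_, ?_⟩ <;> intro x y z hx hy hz hb <;> simp only [Box] at hb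
  · have h1 : Box L (x + 1) y z := by simp only [Box]; omega
    have h2 : Box L (x - 1) y z := by simp only [Box]; omega
    have h3 : ¬ z + 1 = t := by omega
    have h4 : ¬ z - 1 = t := by omega
    simp only [h1, h2, h3, h4, if_true, if_false, ite_self]
    split_ifs <;> rfl
  · have h1 : Box L x (y + 1) z := by simp only [Box]; omega
    have h2 : Box L x (y - 1) z := by simp only [Box]; omega
    have h3 : ¬ z + 1 = t := by omega
    have h4 : ¬ z - 1 = t := by omega
    simp only [h1, h2, h3, h4, if_true, if_false, ite_self]
    split_ifs <;> rfl
  · have h3 : ¬ z = t := by omega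
    simp [h3]

theorem SquareClosed.add {L : ℤ} {W W' : ℤ → ℤ → ℤ → ZMod 2} (h : SquareClosed L W)
    (h' : SquareClosed L W') : SquareClosed L fun x y z => W x y z + W' x y z where
  xz x y z a b c d := by linear_combination h.xz x y z a b c d + h'.xz x y z a b c d
  yz x y z a b c d := by linear_combination h.yz x y z a b c d + h'.yz x y z a b c d
  xy x y z a b c d := by linear_combination h.xy x y z a b c d + h'.xy x y z a b c d

theorem SquareClosed.congr {L : ℤ} {W W' : ℤ → ℤ → ℤ → ZMod 2} (h : SquareClosed L W)
    (h' : ∀ x y z, (z % 2 = 0 ∧ x % 2 = 0 ∧ y % 2 = 0 ∨ z % 2 = 1 ∧ (x + y) % 2 = 1) →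
      W' x y z = W x y z) : SquareClosed L W' := by
  refine ⟨?_, ?_, ?_⟩ <;> intro x y z hx hy hz hb <;>
    rw [h' _ _ _ (by omega), h' _ _ _ (by omega), h' _ _ _ (by omega), h' _ _ _ (by omega)]
  · exact h.xz x y z hx hy hz hb
  · exact h.yz x y z hx hy hz hb
  · exact h.xy x y z hx hy hz hb

/-! ### Exactness for the octahedral code -/

section Cocycle

variable {L : ℤ} {W : ℤ → ℤ → ℤ → ZMod 2}

/-- A primitive of a closed `W`, normalized to vanish on the boundary `z = 0`. -/
noncomputable def octPrim (L : ℤ) (W : ℤ → ℤ → ℤ → ZMod 2) (x y z : ℤ) : ZMod 2 :=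
  -- Reordering the arguments of `W` makes `columnSum` run along the z-axis.
  if OctCell L x y z then columnSum (fun x z y => W x y z) x y ((z + 1) / 2).toNat else 0

theorem octPrim_support (x y z : ℤ) (h : ¬ OctCell L x y z) : octPrim L W x y z = 0 :=
  if_neg h

/-- The difference between `W` and the coboundary of its primitive. -/
noncomputable def octDefect (L : ℤ) (W : ℤ → ℤ → ℤ → ZMod 2) (x y z : ℤ) : ZMod 2 :=
  W x y z + if Box L x y z then octNbr (octPrim L W) x y z else 0

theorem octDefect_out (h0 : ∀ x y z, ¬ Box L x y z → W x y z = 0) (x y z : ℤ)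
    (h : ¬ Box L x y z) : octDefect L W x y z = 0 := by
  simp [octDefect, h0 x y z h, h]

/-- The two octahedra at an even vertex lie in its own vertical column, so the partial sums
telescope. In contrast to the cuboctahedral case, closedness plays no role here. -/
theorem octDefect_vertical (h0 : ∀ x y z, ¬ Box L x y z → W x y z = 0) (hL : L % 2 = 0)
    {x y z : ℤ} (hx : x % 2 = 0) (hy : y % 2 = 0) (hz : z % 2 = 0) (hz' : z ≠ L) :
    octDefect L W x y z = 0 := by
  by_cases hb : Box L x y z
  swap
  · exact octDefect_out h0 x y z hb
  have t2 := two_eq_zero_zmod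
  have ⟨h1, h2, h3, h4, h5, h6⟩ := hb
  rw [octDefect, if_pos hb, octNbr, if_pos hz]
  obtain ⟨n, hn⟩ : ∃ n : ℕ, z = 2 * n := ⟨(z / 2).toNat, by omega⟩
  have low : octPrim L W x y (z - 1) = columnSum (fun x z y => W x y z) x y n := by
    by_cases hc : OctCell L x y (z - 1)
    · rw [octPrim, if_pos hc]
      congr 1
      omega
    · rw [octPrim_support _ _ _ hc]
      simp only [OctCell, Box] at hc
      have : n = 0 := by omega
      simp [this, columnSum]
  have high : octPrim L W x y (z + 1) =
      columnSum (fun x z y => W x y z) x y n + W x y z := by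
    rw [octPrim, if_pos (by simp only [OctCell, Box]; omega),
      show ((z + 1 + 1) / 2).toNat = n + 1 by omega, columnSum_succ, hn]
  rw [low, high]
  linear_combination (W x y z + columnSum (fun x z y => W x y z) x y n) * t2

/-- A vertical face centred at the even height `2 * n` has two even vertices, where `W` vanishes, so
the diamond vertices above and below it agree. The induction starts at `z = -1`, outside the box. -/
theorem horizontal_eq_zero (hW : SquareClosed L W) (h0 : ∀ x y z, ¬ Box L x y z → W x y z = 0)
    (hE : ∀ x y z : ℤ, x % 2 = 0 → y % 2 = 0 → z % 2 = 0 → z ≠ L → W x y z = 0)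
    (n : ℕ) : ∀ x y : ℤ, (x + y) % 2 = 1 → 2 * (n : ℤ) - 1 ≤ L - 1 →
      W x y (2 * n - 1) = 0 := by
  induction n with
  | zero =>
    intro x y _ _
    exact h0 _ _ _ (by simp only [Box]; omega)
  | succ n ih =>
    intro x y hxy hn
    push_cast at hn ⊢
    by_cases hb : Box L x y (2 * n)
    swap
    · exact h0 _ _ _ (by simp only [Box] at hb ⊢; omega)
    rcases (by omega : x % 2 = 1 ∧ y % 2 = 0 ∨ x % 2 = 0 ∧ y % 2 = 1) with ⟨hx, hy⟩ | ⟨hx, hy⟩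
    · have t := hW.xz x y (2 * n) hx hy (by omega) hb
      rw [hE _ _ _ (by omega) hy (by omega) (by omega),
        hE _ _ _ (by omega) hy (by omega) (by omega), ih x y hxy (by omega)] at t
      rw [show (2 * (n + 1) - 1 : ℤ) = 2 * n + 1 by ring]
      simpa using t
    · have t := hW.yz x y (2 * n) hx hy (by omega) hb
      rw [hE _ _ _ hx (by omega) (by omega) (by omega),
        hE _ _ _ hx (by omega) (by omega) (by omega), ih x y hxy (by omega)] at t
      rw [show (2 * (n + 1) - 1 : ℤ) = 2 * n + 1 by ring]
      simpa using t

/-- In a face centred on `z = L` the vertices above and below the plane carry zero, so neighbouring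
even vertices of the plane agree. -/
theorem octTop_const (hW : SquareClosed L W)
    (hL : L % 2 = 0)
    (hB : ∀ x y z : ℤ, z % 2 = 1 → (x + y) % 2 = 1 → W x y z = 0)
    {x y : ℤ} (hx : x % 2 = 0) (hx0 : 0 ≤ x) (hxL : x ≤ L) (hy : y % 2 = 0) (hy0 : 0 ≤ y)
    (hyL : y ≤ L) : W x y L = W 0 0 L := by
  have t2 := two_eq_zero_zmod
  have xdir : ∀ m : ℕ, 2 * (m : ℤ) ≤ L → W (2 * m) y L = W 0 y L := by
    intro m
    induction m with
    | zero => simp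
    | succ m ih =>
      intro hm
      push_cast at hm ⊢
      have t := hW.xz (2 * m + 1) y L (by omega) hy hL (by simp only [Box]; omega)
      rw [hB (2 * m + 1) y (L + 1) (by omega) (by omega), hB (2 * m + 1) y (L - 1) (by omega) (by omega),
        add_sub_cancel_right] at t
      rw [← ih (by omega), show (2 * (m + 1) : ℤ) = 2 * m + 1 + 1 by ring]
      linear_combination t - W (2 * m) y L * t2
  have ydir : ∀ m : ℕ, 2 * (m : ℤ) ≤ L → W 0 (2 * m) L = W 0 0 L := by
    intro m
    induction m with
    | zero => simp
    | succ m ih =>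
      intro hm
      push_cast at hm ⊢
      have t := hW.yz 0 (2 * m + 1) L (by omega) (by omega) hL (by simp only [Box]; omega)
      rw [hB 0 (2 * m + 1) (L + 1) (by omega) (by omega), hB 0 (2 * m + 1) (L - 1) (by omega) (by omega),
        add_sub_cancel_right] at t
      rw [← ih (by omega), show (2 * (m + 1) : ℤ) = 2 * m + 1 + 1 by ring]
      linear_combination t - W 0 (2 * m) L * t2
  have a1 := xdir (x / 2).toNat (by omega)
  have a2 := ydir (y / 2).toNat (by omega)
  rw [show 2 * (((x / 2).toNat : ℕ) : ℤ) = x by omega] at a1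
  rw [show 2 * (((y / 2).toNat : ℕ) : ℤ) = y by omega] at a2
  rw [a1, a2]

/-- A closed function on the octahedral code is a coboundary up to a multiple of the boundary
`z = L`. -/
theorem SquareClosed.exists_primitive (hW : SquareClosed L W)
    (h0 : ∀ x y z, ¬ Box L x y z → W x y z = 0) (hL : L % 2 = 0) :
    ∃ (f : ℤ → ℤ → ℤ → ZMod 2) (a : ZMod 2), (∀ x y z, ¬ OctCell L x y z → f x y z = 0) ∧
      ∀ x y z, Box L x y z →
        (z % 2 = 0 ∧ x % 2 = 0 ∧ y % 2 = 0 ∨ z % 2 = 1 ∧ (x + y) % 2 = 1) →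
        W x y z = octNbr f x y z + if z = L then a else 0 := by
  have t2 := two_eq_zero_zmod
  have hD : SquareClosed L (octDefect L W) := hW.add (squareClosed_octNbr hL octPrim_support)
  have hD0 := octDefect_out h0
  have hE := fun (x y z : ℤ) => @octDefect_vertical L W h0 hL x y z
  have hB : ∀ x y z : ℤ, z % 2 = 1 → (x + y) % 2 = 1 → octDefect L W x y z = 0 := by
    intro x y z hz hx
    by_cases hb : Box L x y z
    · simp only [Box] at hb
      have := horizontal_eq_zero hD hD0 hE ((z + 1) / 2).toNat x y hx (by omega)
      rwa [show 2 * ((((z + 1) / 2).toNat : ℕ) : ℤ) - 1 = z by omega] at this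
    · exact hD0 _ _ _ hb
  refine ⟨octPrim L W, octDefect L W 0 0 L, octPrim_support, ?_⟩
  intro x y z hb hs
  have key : octDefect L W x y z = if z = L then octDefect L W 0 0 L else 0 := by
    have hb' := hb
    simp only [Box] at hb'
    split_ifs with hz
    · subst hz
      exact octTop_const hD hL hB (by omega) (by omega) (by omega) (by omega) (by omega)
        (by omega)
    · rcases hs with ⟨h1, h2, h3⟩ | ⟨h1, h2⟩
      · exact hE _ _ _ h2 h3 h1 hz
      · exact hB _ _ _ h1 h2
  rw [← key, octDefect, if_pos hb]
  linear_combination - octNbr (octPrim L W) x y z * t2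

end Cocycle

/-! ### Vectors on the vertices as functions on the integer grid -/

/-- Sum of the values of a binary vector over a set of vertices. -/
noncomputable def check {d : ℕ} (S : Set (Vertex d)) (x : Vertex d → ZMod 2) : ZMod 2 :=
  ∑ v, binVec d S v * x v

theorem check_add {d : ℕ} (S : Set (Vertex d)) (x y : Vertex d → ZMod 2) :
    check S (x + y) = check S x + check S y := by
  simp [check, mul_add, Finset.sum_add_distrib]

theorem check_smul {d : ℕ} (S : Set (Vertex d)) (a : ZMod 2) (x : Vertex d → ZMod 2) :
    check S (a • x) = a * check S x := by
  simp [check, Finset.mul_sum, mul_left_comm]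

/-- Extension of a vector on the vertices by zero to the whole grid. -/
noncomputable def extend {d : ℕ} (x : Vertex d → ZMod 2) (p : Point) : ZMod 2 :=
  if h : p ∈ siteFinset d then x ⟨p, h⟩ else 0

theorem extend_val {d : ℕ} (x : Vertex d → ZMod 2) (v : Vertex d) : extend x v.1 = x v := by
  simp [extend]

theorem side_even (d : ℕ) : side d % 2 = 0 := by simp only [side]; omega

theorem two_le_side {d : ℕ} (hd : 2 ≤ d) : 2 ≤ side d := by simp only [side]; omega

theorem mem_siteFinset {d : ℕ} {x y z : ℤ} : (x, y, z) ∈ siteFinset d ↔ Box (side d) x y z ∧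
    (z % 2 = 0 ∧ x % 2 = 0 ∧ y % 2 = 0 ∨ z % 2 = 1 ∧ (x + y) % 2 = 1) := by
  simp only [siteFinset, Finset.mem_filter, Finset.mem_product, Finset.mem_Icc, IsSite, Box,
    Int.even_iff, Int.odd_iff]
  tauto

theorem extend_out {d : ℕ} (w : Vertex d → ZMod 2) {x y z : ℤ} (h : ¬ Box (side d) x y z) :
    extend w (x, y, z) = 0 :=
  dif_neg fun h' => h (mem_siteFinset.1 h').1

/-- The set `T` may contain points outside the lattice, since `extend` vanishes there. Faces cut by
the boundary can thus be handled as complete ones. -/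
theorem check_eq_sum {d : ℕ} {S : Set (Vertex d)} {T : Finset Point}
    (h : ∀ v : Vertex d, v ∈ S ↔ v.1 ∈ T) (x : Vertex d → ZMod 2) :
    check S x = ∑ p ∈ T, extend x p := by
  classical
  have h1 : check S x = ∑ v : Vertex d, (fun p => if p ∈ T then extend x p else 0) v.1 := by
    refine Finset.sum_congr rfl fun v _ => ?_
    by_cases hv : v ∈ S
    · simp [binVec, hv, (h v).1 hv, extend_val]
    · simp [binVec, hv, mt (h v).2 hv]
  rw [h1, Finset.sum_coe_sort (siteFinset d) (fun p => if p ∈ T then extend x p else 0),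
    Finset.sum_ite_mem]
  refine Finset.sum_subset Finset.inter_subset_right fun p hp hp' => ?_
  exact dif_neg fun hs => hp' (Finset.mem_inter.2 ⟨hs, hp⟩)

/-- This turns quadratic incidence conditions into finite ranges, to which linear integer arithmetic
applies. -/
theorem bounds_of_sq_add {a b c n : ℤ} (h : a ^ 2 + b ^ 2 + c ^ 2 = n) (hn : n < 4) :
    -1 ≤ a ∧ a ≤ 1 ∧ -1 ≤ b ∧ b ≤ 1 ∧ -1 ≤ c ∧ c ≤ 1 := by
  refine ⟨?_, ?_, ?_, ?_, ?_, ?_⟩ <;>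
    nlinarith [sq_nonneg a, sq_nonneg b, sq_nonneg c]

/-! ### The cuboctahedral codes -/

/-- The permutation of the coordinates which puts the `c`-boundaries at `y = 0` and `y = L`. -/
def orient : Colour → Point → Point
  | .r, p => (p.2.1, p.1, p.2.2)
  | _, p => p

/-- Exchange of the two cuboctahedral colours. -/
def opposite : Colour → Colour
  | .r => .b
  | .g => .g
  | .b => .r

/-- The residue modulo `4` of the coordinate sums of the centres of the `c`-cuboctahedra. -/
def residue : Colour → ℤ
  | .r => 2
  | _ => 0

theorem orient_orient (c : Colour) (p : Point) : orient c (orient c p) = p := by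
  cases c <;> rfl

theorem sqDist_orient (c : Colour) (p q : Point) :
    sqDist (orient c p) (orient c q) = sqDist p q := by
  cases c <;> simp only [sqDist, orient] <;> ring

theorem sqDist_orient_mk (c : Colour) (x y z x' y' z' : ℤ) :
    sqDist (orient c (x, y, z)) (orient c (x', y', z')) =
      (x - x') ^ 2 + (y - y') ^ 2 + (z - z') ^ 2 :=
  sqDist_orient c _ _

theorem residue_even (c : Colour) : residue c % 2 = 0 := by cases c <;> rfl

theorem isCell_orient {d : ℕ} {c : Colour} (hc : c ≠ .g) (x y z : ℤ) :
    IsCell d c (orient c (x, y, z)) ↔ CubCell (residue c) (side d) x y z := by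
  have := side_even d
  cases c
  · simp only [IsCell, orient, IsCentre, InBox, IsFlattened, CubCell, residue, Int.odd_iff,
      Int.even_iff]
    omega
  · exact absurd rfl hc
  · simp only [IsCell, orient, IsCentre, InBox, IsFlattened, CubCell, residue, Int.odd_iff,
      Int.even_iff]
    omega

theorem isCell_opposite_orient {d : ℕ} {c : Colour} (hc : c ≠ .g) (x y z : ℤ) :
    IsCell d (opposite c) (orient c (x, y, z)) ↔ OppCell (residue c) (side d) x y z := by
  have := side_even d
  cases c
  · simp only [IsCell, orient, IsCentre, InBox, IsFlattened, OppCell, residue, Int.odd_iff,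
      Int.even_iff, opposite]
    omega
  · exact absurd rfl hc
  · simp only [IsCell, orient, IsCentre, InBox, IsFlattened, OppCell, residue, Int.odd_iff,
      Int.even_iff, opposite]
    omega

theorem isCell_g_orient {d : ℕ} (c : Colour) (x y z : ℤ) :
    IsCell d .g (orient c (x, y, z)) ↔ OctCell (side d) x y z := by
  cases c <;>
  · simp only [IsCell, orient, IsCentre, InBox, IsFlattened, OctCell, Box, Int.odd_iff,
      Int.even_iff, or_false]
    omega

theorem orient_mem_siteFinset {d : ℕ} {c : Colour} {x y z : ℤ} :
    orient c (x, y, z) ∈ siteFinset d ↔ Box (side d) x y z ∧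
    (z % 2 = 0 ∧ x % 2 = 0 ∧ y % 2 = 0 ∨ z % 2 = 1 ∧ (x + y) % 2 = 1) := by
  cases c <;> simp only [orient, mem_siteFinset, Box] <;> omega

theorem mem_zSupports_cub {d : ℕ} {c : Colour} (hc : c ≠ .g) {S : Set (Vertex d)} :
    S ∈ zSupports d c ↔ ∃ p q, IsCell d (opposite c) p ∧ IsCell d .g q ∧ sqDist p q = 3 ∧
      S = cellSupport d (opposite c) p ∩ cellSupport d .g q := by
  cases c
  · rfl
  · exact absurd rfl hc
  · rfl

theorem sqRadius_opposite {c : Colour} (hc : c ≠ .g) : sqRadius (opposite c) = 2 := by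
  cases c
  · rfl
  · exact absurd rfl hc
  · rfl

theorem sqRadius_cub {c : Colour} (hc : c ≠ .g) : sqRadius c = 2 := by
  cases c
  · rfl
  · exact absurd rfl hc
  · rfl

theorem exists_orient (c : Colour) (p : Point) : ∃ x y z : ℤ, p = orient c (x, y, z) :=
  ⟨(orient c p).1, (orient c p).2.1, (orient c p).2.2, (orient_orient c p).symm⟩

theorem orient_injective (c : Colour) : Function.Injective (orient c) :=
  Function.LeftInverse.injective (g := orient c) (orient_orient c)

theorem check_triangle {d : ℕ} {c : Colour} (hc : c ≠ .g) {x y z i j k : ℤ}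
    (hi : i = 1 ∨ i = -1) (hj : j = 1 ∨ j = -1) (hk : k = 1 ∨ k = -1) (w : Vertex d → ZMod 2) :
    check (cellSupport d (opposite c) (orient c (x, y, z)) ∩
        cellSupport d .g (orient c (x + i, y + j, z + k))) w =
      extend w (orient c (x, y + j, z + k)) + extend w (orient c (x + i, y, z + k)) +
        extend w (orient c (x + i, y + j, z)) := by
  rw [check_eq_sum (T := {orient c (x, y + j, z + k), orient c (x + i, y, z + k),
    orient c (x + i, y + j, z)})]
  · rw [Finset.sum_insert, Finset.sum_pair, add_assoc]
    · rw [(orient_injective c).ne_iff]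
      simp only [ne_eq, Prod.mk.injEq]
      omega
    · simp only [Finset.mem_insert, Finset.mem_singleton, (orient_injective c).eq_iff,
        Prod.mk.injEq]
      omega
  · rintro ⟨p, hp⟩
    obtain ⟨u1, u2, u3, rfl⟩ := exists_orient c p
    have hg : sqRadius .g = 1 := rfl
    simp only [cellSupport, Set.mem_inter_iff, Set.mem_ofPred_eq, sqDist_orient_mk,
      sqRadius_opposite hc, hg, Finset.mem_insert, Finset.mem_singleton,
      (orient_injective c).eq_iff, Prod.mk.injEq]
    constructor
    · rintro ⟨h1, h2⟩
      have b1 := bounds_of_sq_add h1 (by norm_num)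
      -- The difference of the two distance equations is linear. With coordinates between -1 and 1,
      -- a signed sum of 2 leaves just the three vertices of the triangle.
      have hlin : i * (u1 - x) + j * (u2 - y) + k * (u3 - z) = 2 := by
        have hi2 : i ^ 2 = 1 := by rcases hi with rfl | rfl <;> norm_num
        have hj2 : j ^ 2 = 1 := by rcases hj with rfl | rfl <;> norm_num
        have hk2 : k ^ 2 = 1 := by rcases hk with rfl | rfl <;> norm_num
        linarith
      rcases hi with rfl | rfl <;> rcases hj with rfl | rfl <;> rcases hk with rfl | rfl <;> omega
    · have hi2 : i ^ 2 = 1 := by rcases hi with rfl | rfl <;> norm_num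
      have hj2 : j ^ 2 = 1 := by rcases hj with rfl | rfl <;> norm_num
      have hk2 : k ^ 2 = 1 := by rcases hk with rfl | rfl <;> norm_num
      rintro (⟨rfl, rfl, rfl⟩ | ⟨rfl, rfl, rfl⟩ | ⟨rfl, rfl, rfl⟩) <;>
        constructor <;> ring_nf <;> linarith

/-- The centres of a cuboctahedron and an octahedron have opposite parity in each coordinate, so
squared distance 3 means that all three differences are 1 or -1. These signs are the `a`, `b`, `c`
of `TriClosed`. -/
theorem checks_cub_iff {d : ℕ} {c : Colour} (hc : c ≠ .g) (w : Vertex d → ZMod 2) :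
    (∀ S ∈ zSupports d c, check S w = 0) ↔
      TriClosed (residue c) (side d) fun x y z => extend w (orient c (x, y, z)) := by
  constructor
  · intro h x y z i j k hp hi hj hk hb
    rw [← check_triangle hc hi hj hk]
    refine h _ ((mem_zSupports_cub hc).2 ⟨_, _, (isCell_opposite_orient hc _ _ _).2 hp,
      (isCell_g_orient c _ _ _).2 ⟨?_, ?_, ?_, hb⟩, ?_, rfl⟩)
    · have := hp.1; omega
    · have := hp.2.1; omega
    · have := hp.2.2.1; omega
    · rw [sqDist_orient_mk]
      rcases hi with rfl | rfl <;> rcases hj with rfl | rfl <;> rcases hk with rfl | rfl <;>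
        ring
  · intro h S hS
    obtain ⟨p, q, hp, hq, hpq, rfl⟩ := (mem_zSupports_cub hc).1 hS
    obtain ⟨x, y, z, rfl⟩ := exists_orient c p
    obtain ⟨x', y', z', rfl⟩ := exists_orient c q
    rw [isCell_opposite_orient hc] at hp
    rw [isCell_g_orient] at hq
    rw [sqDist_orient_mk] at hpq
    have b := bounds_of_sq_add hpq (by norm_num)
    have ⟨p1, p2, p3, _⟩ := hp
    have ⟨q1, q2, q3, hb⟩ := hq
    have t := check_triangle hc (x := x) (y := y) (z := z) (i := x' - x) (j := y' - y)
      (k := z' - z) (by omega) (by omega) (by omega) w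
    have t' := h x y z (x' - x) (y' - y) (z' - z) hp (by omega) (by omega) (by omega)
      (by simpa using hb)
    rw [add_sub_cancel, add_sub_cancel, add_sub_cancel] at t
    simp only [add_sub_cancel] at t'
    rw [t, t']

/-- This identifies the grid coboundary with cell supports: by parity, the four positions in
`cubNbr` are all the cuboctahedral centres at squared distance 2 from a vertex. -/
theorem cubNbr_single {e L x y z u1 u2 u3 : ℤ} (hp : CubCell e L x y z)
    (hu : u3 % 2 = 0 ∧ u1 % 2 = 0 ∧ u2 % 2 = 0 ∨ u3 % 2 = 1 ∧ (u1 + u2) % 2 = 1) :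
    cubNbr (fun a b c => if a = x ∧ b = y ∧ c = z then 1 else 0) u1 u2 u3 =
      if (u1 - x) ^ 2 + (u2 - y) ^ 2 + (u3 - z) ^ 2 = 2 then 1 else 0 := by
  obtain ⟨p1, p2, p3, -⟩ := hp
  have far : ∀ i j k : ℤ, i ^ 2 + j ^ 2 + k ^ 2 = 2 →
      ¬ (u1 - x) ^ 2 + (u2 - y) ^ 2 + (u3 - z) ^ 2 = 2 →
      ¬ (u1 + i = x ∧ u2 + j = y ∧ u3 + k = z) := by
    rintro i j k hs h ⟨rfl, rfl, rfl⟩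
    apply h
    rw [← hs]; ring
  rw [cubNbr]
  by_cases h : (u1 - x) ^ 2 + (u2 - y) ^ 2 + (u3 - z) ^ 2 = 2
  · have b := bounds_of_sq_add h (by norm_num)
    rw [if_pos h]
    rcases hu with ⟨h3, h1, h2⟩ | ⟨h3, h12⟩
    · rw [if_pos h3]
      split_ifs <;> first | rfl | (exfalso; omega)
    · rw [if_neg (by omega)]
      split_ifs <;> first | rfl | (exfalso; omega)
  · rw [if_neg h]
    have f1 := fun i j => far i j 0
    have f2 := fun j k => far 0 j k
    have f3 := fun i k => far i 0 k
    simp only [add_zero] at f1 f2 f3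
    split_ifs with g1 g2 g3 g4 <;> first | rfl | (exfalso; omega) | skip
    all_goals exfalso
    all_goals first
      | exact f1 1 1 (by norm_num) h (by omega)
      | exact f1 1 (-1) (by norm_num) h (by omega)
      | exact f1 (-1) 1 (by norm_num) h (by omega)
      | exact f1 (-1) (-1) (by norm_num) h (by omega)
      | exact f2 1 1 (by norm_num) h (by omega)
      | exact f2 1 (-1) (by norm_num) h (by omega)
      | exact f2 (-1) 1 (by norm_num) h (by omega)
      | exact f2 (-1) (-1) (by norm_num) h (by omega)
      | exact f3 1 1 (by norm_num) h (by omega)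
      | exact f3 1 (-1) (by norm_num) h (by omega)
      | exact f3 (-1) 1 (by norm_num) h (by omega)
      | exact f3 (-1) (-1) (by norm_num) h (by omega)

theorem binVec_cub {d : ℕ} {c : Colour} (hc : c ≠ .g) {x y z u1 u2 u3 : ℤ}
    (hp : CubCell (residue c) (side d) x y z) (hu : orient c (u1, u2, u3) ∈ siteFinset d) :
    binVec d (cellSupport d c (orient c (x, y, z))) ⟨orient c (u1, u2, u3), hu⟩ =
      cubNbr (fun a b c => if a = x ∧ b = y ∧ c = z then 1 else 0) u1 u2 u3 := by
  rw [cubNbr_single hp (orient_mem_siteFinset.1 hu).2]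
  simp [binVec, Set.indicator_apply, cellSupport, sqDist_orient_mk, sqRadius_cub hc]

theorem check_cub_cell {d : ℕ} {c : Colour} (hc : c ≠ .g) {p : Point} (hp : IsCell d c p)
    {S : Set (Vertex d)} (hS : S ∈ zSupports d c) :
    check S (binVec d (cellSupport d c p)) = 0 := by
  obtain ⟨x, y, z, rfl⟩ := exists_orient c p
  rw [isCell_orient hc] at hp
  refine (checks_cub_iff hc _).2 ?_ S hS
  have key := triClosed_cubNbr (e := residue c) (side_even d)
    (f := fun a b c => if a = x ∧ b = y ∧ c = z then 1 else 0) (by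
      rintro a b c' h
      refine if_neg ?_
      rintro ⟨rfl, rfl, rfl⟩
      exact h hp)
  refine key.congr ?_
  intro u1 u2 u3 hu
  split_ifs with hb
  · have hm := (orient_mem_siteFinset (c := c)).2 ⟨hb, hu⟩
    rw [extend, dif_pos hm, binVec_cub hc hp]
  · exact dif_neg fun h => hb (orient_mem_siteFinset.1 h).1

theorem axis_orient {c : Colour} (hc : c ≠ .g) (x y z : ℤ) : axis c (orient c (x, y, z)) = y := by
  cases c
  · rfl
  · exact absurd rfl hc
  · rfl

theorem binVec_boundary_cub {d : ℕ} {c : Colour} (hc : c ≠ .g) (s : Bool) {u1 u2 u3 : ℤ}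
    (hu : orient c (u1, u2, u3) ∈ siteFinset d) :
    binVec d (boundary d c s) ⟨orient c (u1, u2, u3), hu⟩ =
      if u2 = if s then side d else 0 then 1 else 0 := by
  have h : ((⟨orient c (u1, u2, u3), hu⟩ : Vertex d) ∈ boundary d c s) ↔
      u2 = if s then side d else 0 := by
    change axis c (orient c (u1, u2, u3)) = _ ↔ _
    rw [axis_orient hc]
  classical
  rw [binVec, Set.indicator_apply]
  simp only [h, Pi.one_apply]

theorem check_cub_boundary {d : ℕ} {c : Colour} (hc : c ≠ .g) (s : Bool)
    {S : Set (Vertex d)} (hS : S ∈ zSupports d c) :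
    check S (binVec d (boundary d c s)) = 0 := by
  refine (checks_cub_iff hc _).2 ?_ S hS
  have key := triClosed_boundary (e := residue c) (t := if s then side d else 0) (side_even d)
    (by cases s <;> simp)
  refine key.congr ?_
  intro u1 u2 u3 hu
  by_cases hb : Box (side d) u1 u2 u3
  · have hm := (orient_mem_siteFinset (c := c)).2 ⟨hb, hu⟩
    rw [if_pos hb, extend, dif_pos hm, binVec_boundary_cub hc]
  · rw [if_neg hb]
    exact dif_neg fun h => hb (orient_mem_siteFinset.1 h).1

theorem cubNbr_sum {ι : Type*} (T : Finset ι) (F : ι → ℤ → ℤ → ℤ → ZMod 2) (a : ι → ZMod 2)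
    (x y z : ℤ) :
    cubNbr (fun i j k => ∑ p ∈ T, a p * F p i j k) x y z = ∑ p ∈ T, a p * cubNbr (F p) x y z := by
  simp only [cubNbr]
  split_ifs <;> simp only [mul_add, Finset.sum_add_distrib]

/-- The primitive is a finite combination of indicators of single cells, and the coboundary of each
indicator is an `X` stabilizer. -/
theorem exists_xSpan_add_cub {d : ℕ} (hd : 2 ≤ d) {c : Colour} (hc : c ≠ .g)
    {w : Vertex d → ZMod 2} (hw : ∀ S ∈ zSupports d c, check S w = 0) :
    ∃ a : ZMod 2, ∃ h ∈ xSpan d c, w = a • binVec d (boundary d c true) + h := by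
  classical
  have hW := (checks_cub_iff hc w).1 hw
  obtain ⟨f, a, hf, heq⟩ := hW.exists_primitive
    (fun x y z h => dif_neg fun h' => h (orient_mem_siteFinset.1 h').1)
    (side_even d) (two_le_side hd) (residue_even c)
  -- The range goes one step beyond the box on each side, to include the flattened cells.
  let I := Finset.Icc (-1) (side d + 1)
  let T : Finset Point := (I ×ˢ I ×ˢ I).filter fun p => CubCell (residue c) (side d) p.1 p.2.1 p.2.2
  have hT : ∀ x y z, (x, y, z) ∈ T ↔ CubCell (residue c) (side d) x y z := by
    intro x y z
    simp only [T, I, Finset.mem_filter, Finset.mem_product, Finset.mem_Icc, and_iff_right_iff_imp]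
    rintro ⟨_, _, _, _, h⟩
    omega
  refine ⟨a, ∑ p ∈ T, f p.1 p.2.1 p.2.2 • binVec d (cellSupport d c (orient c p)), ?_, ?_⟩
  · refine Submodule.sum_mem _ fun p hp => Submodule.smul_mem _ _ (Submodule.subset_span ?_)
    exact ⟨_, ⟨_, (isCell_orient hc _ _ _).2 ((hT _ _ _).1 hp), rfl⟩, rfl⟩
  · have hf' : f = fun i j k => ∑ p ∈ T, f p.1 p.2.1 p.2.2 *
        (fun (p : Point) a b c => if a = p.1 ∧ b = p.2.1 ∧ c = p.2.2 then 1 else 0) p i j k := by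
      funext i j k
      by_cases h : CubCell (residue c) (side d) i j k
      · rw [Finset.sum_eq_single (i, j, k)]
        · simp
        · intro p _ hne
          have : ¬ (i = p.1 ∧ j = p.2.1 ∧ k = p.2.2) := by
            rintro ⟨rfl, rfl, rfl⟩; exact hne rfl
          simp [this]
        · intro h'; exact absurd ((hT _ _ _).2 h) h'
      · rw [hf _ _ _ h]
        symm
        refine Finset.sum_eq_zero fun p hp => ?_
        have : ¬ (i = p.1 ∧ j = p.2.1 ∧ k = p.2.2) := by
          rintro ⟨rfl, rfl, rfl⟩; exact h ((hT _ _ _).1 hp)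
        simp [this]
    funext ⟨v, hv⟩
    obtain ⟨u1, u2, u3, rfl⟩ := exists_orient c v
    have ⟨hb, hu⟩ := orient_mem_siteFinset.1 hv
    have h := heq u1 u2 u3 hb hu
    rw [extend, dif_pos hv] at h
    rw [h, hf', cubNbr_sum, add_comm, Pi.add_apply, Finset.sum_apply]
    congr 1
    · simp [binVec_boundary_cub hc]
    · refine Finset.sum_congr rfl fun p hp => ?_
      rw [Pi.smul_apply, smul_eq_mul, ← binVec_cub hc ((hT _ _ _).1 hp) hv]
      congr 1
      rw [← hf']

/-! ### The octahedral code -/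

/-- Subtracting the equations places the point in the mid-plane, on a circle of radius 1. The faces
in the other directions follow by permuting coordinates. -/
theorem mem_of_sqDist_pair {m1 m2 m3 u1 u2 u3 : ℤ}
    (h1 : (u1 - m1) ^ 2 + (u2 - (m2 + 1)) ^ 2 + (u3 - m3) ^ 2 = 2)
    (h2 : (u1 - m1) ^ 2 + (u2 - (m2 - 1)) ^ 2 + (u3 - m3) ^ 2 = 2) :
    u2 = m2 ∧ (u1 = m1 + 1 ∧ u3 = m3 ∨ u1 = m1 - 1 ∧ u3 = m3 ∨ u1 = m1 ∧ u3 = m3 + 1 ∨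
      u1 = m1 ∧ u3 = m3 - 1) := by
  have b := bounds_of_sq_add h1 (by norm_num)
  have e : u2 = m2 := by linarith
  subst e
  have h : (u1 - m1) ^ 2 + (u3 - m3) ^ 2 = 1 := by linarith
  obtain ⟨x, hx⟩ : ∃ x, u1 = m1 + x := ⟨u1 - m1, by ring⟩
  obtain ⟨z, hz⟩ : ∃ z, u3 = m3 + z := ⟨u3 - m3, by ring⟩
  subst hx hz
  rw [add_sub_cancel_left] at h b
  rw [add_sub_cancel_left] at h b
  have : x = -1 ∨ x = 0 ∨ x = 1 := by omega
  have : z = -1 ∨ z = 0 ∨ z = 1 := by omega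
  refine ⟨rfl, ?_⟩
  rcases ‹x = -1 ∨ x = 0 ∨ x = 1› with rfl | rfl | rfl <;>
    rcases ‹z = -1 ∨ z = 0 ∨ z = 1› with rfl | rfl | rfl <;> omega

theorem check_square_xz {d : ℕ} {x y z : ℤ} {c c' : Colour} (hc : c ≠ .g) (hc' : c' ≠ .g)
    (w : Vertex d → ZMod 2) :
    check (cellSupport d c (x, y + 1, z) ∩ cellSupport d c' (x, y - 1, z)) w =
      extend w (x + 1, y, z) + extend w (x - 1, y, z) + extend w (x, y, z + 1) +
        extend w (x, y, z - 1) := by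
  rw [check_eq_sum (T := {(x + 1, y, z), (x - 1, y, z), (x, y, z + 1), (x, y, z - 1)})]
  · rw [Finset.sum_insert, Finset.sum_insert, Finset.sum_pair, add_assoc, add_assoc]
    all_goals
      simp only [ne_eq, Finset.mem_insert, Finset.mem_singleton, Prod.mk.injEq]
      omega
  · rintro ⟨⟨u1, u2, u3⟩, hu⟩
    simp only [cellSupport, Set.mem_inter_iff, Set.mem_ofPred_eq, sqDist, sqRadius_cub hc,
      sqRadius_cub hc', Finset.mem_insert, Finset.mem_singleton, Prod.mk.injEq]
    constructor
    · rintro ⟨h1, h2⟩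
      have := mem_of_sqDist_pair h1 h2
      omega
    · rintro (⟨rfl, rfl, rfl⟩ | ⟨rfl, rfl, rfl⟩ | ⟨rfl, rfl, rfl⟩ | ⟨rfl, rfl, rfl⟩) <;>
        constructor <;> ring

theorem check_square_yz {d : ℕ} {x y z : ℤ} {c c' : Colour} (hc : c ≠ .g) (hc' : c' ≠ .g)
    (w : Vertex d → ZMod 2) :
    check (cellSupport d c (x + 1, y, z) ∩ cellSupport d c' (x - 1, y, z)) w =
      extend w (x, y + 1, z) + extend w (x, y - 1, z) + extend w (x, y, z + 1) +
        extend w (x, y, z - 1) := by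
  rw [check_eq_sum (T := {(x, y + 1, z), (x, y - 1, z), (x, y, z + 1), (x, y, z - 1)})]
  · rw [Finset.sum_insert, Finset.sum_insert, Finset.sum_pair, add_assoc, add_assoc]
    all_goals
      simp only [ne_eq, Finset.mem_insert, Finset.mem_singleton, Prod.mk.injEq]
      omega
  · rintro ⟨⟨u1, u2, u3⟩, hu⟩
    simp only [cellSupport, Set.mem_inter_iff, Set.mem_ofPred_eq, sqDist, sqRadius_cub hc,
      sqRadius_cub hc', Finset.mem_insert, Finset.mem_singleton, Prod.mk.injEq]
    constructor
    · rintro ⟨h1, h2⟩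
      have := mem_of_sqDist_pair (m1 := y) (m2 := x) (m3 := z) (u1 := u2) (u2 := u1) (u3 := u3)
        (by linarith) (by linarith)
      omega
    · rintro (⟨rfl, rfl, rfl⟩ | ⟨rfl, rfl, rfl⟩ | ⟨rfl, rfl, rfl⟩ | ⟨rfl, rfl, rfl⟩) <;>
        constructor <;> ring

theorem check_square_xy {d : ℕ} {x y z : ℤ} {c c' : Colour} (hc : c ≠ .g) (hc' : c' ≠ .g)
    (w : Vertex d → ZMod 2) :
    check (cellSupport d c (x, y, z + 1) ∩ cellSupport d c' (x, y, z - 1)) w =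
      extend w (x + 1, y, z) + extend w (x - 1, y, z) + extend w (x, y + 1, z) +
        extend w (x, y - 1, z) := by
  rw [check_eq_sum (T := {(x + 1, y, z), (x - 1, y, z), (x, y + 1, z), (x, y - 1, z)})]
  · rw [Finset.sum_insert, Finset.sum_insert, Finset.sum_pair, add_assoc, add_assoc]
    all_goals
      simp only [ne_eq, Finset.mem_insert, Finset.mem_singleton, Prod.mk.injEq]
      omega
  · rintro ⟨⟨u1, u2, u3⟩, hu⟩
    simp only [cellSupport, Set.mem_inter_iff, Set.mem_ofPred_eq, sqDist, sqRadius_cub hc,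
      sqRadius_cub hc', Finset.mem_insert, Finset.mem_singleton, Prod.mk.injEq]
    constructor
    · rintro ⟨h1, h2⟩
      have := mem_of_sqDist_pair (m1 := x) (m2 := z) (m3 := y) (u1 := u1) (u2 := u3) (u3 := u2)
        (by linarith) (by linarith)
      omega
    · rintro (⟨rfl, rfl, rfl⟩ | ⟨rfl, rfl, rfl⟩ | ⟨rfl, rfl, rfl⟩ | ⟨rfl, rfl, rfl⟩) <;>
        constructor <;> ring

theorem nonempty_of_check_ne_zero {d : ℕ} {S : Set (Vertex d)} {w : Vertex d → ZMod 2}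
    (h : check S w ≠ 0) : S.Nonempty := by
  by_contra hS
  rw [Set.not_nonempty_iff_eq_empty] at hS
  simp [hS, check, binVec] at h

theorem isCentre_rb {x y z : ℤ} (hx : x % 2 = 1) (hy : y % 2 = 1) (hz : z % 2 = 0) :
    (IsCentre .r (x, y, z) ↔ (x + y + z) % 4 = 2) ∧
      (IsCentre .b (x, y, z) ↔ (x + y + z) % 4 = 0) := by
  simp only [IsCentre, Int.odd_iff, Int.even_iff]
  omega

/-- Two cuboctahedra of opposite colours at distance two cut out a `Z` check of the octahedral
code. -/
theorem check_rb_eq_zero {d : ℕ} {w : Vertex d → ZMod 2}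
    (h : ∀ S ∈ zSupports d .g, check S w = 0) {x y z x' y' z' : ℤ} (hx : x % 2 = 1)
    (hy : y % 2 = 1) (hz : z % 2 = 0) (hx' : x' % 2 = 1) (hy' : y' % 2 = 1) (hz' : z' % 2 = 0)
    (hb : Box (side d) x y z ∨ Box (side d) x' y' z')
    (hd : (x - x') ^ 2 + (y - y') ^ 2 + (z - z') ^ 2 = 4)
    (hr : (x + y + z - x' - y' - z') % 4 = 2) :
    check (cellSupport d .r (x, y, z) ∩ cellSupport d .r (x', y', z')) w = 0 := by
  by_contra hne
  have hS := nonempty_of_check_ne_zero hne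
  refine hne (h _ ⟨hS, ?_⟩)
  have hB : ∀ {a b c : ℤ}, Box (side d) a b c → InBox d (a, b, c) := by
    intro a b c ⟨h1, h2, h3, h4, h5, h6⟩
    exact ⟨⟨h1, h2⟩, ⟨h3, h4⟩, h5, h6⟩
  have i1 := isCentre_rb hx hy hz
  have i2 := isCentre_rb hx' hy' hz'
  rcases (by omega : (x + y + z) % 4 = 2 ∨ (x + y + z) % 4 = 0) with hm | hm
  · exact ⟨_, _, i1.1.2 hm, i2.2.2 (by omega), hb.imp hB hB, hd, rfl⟩
  · exact ⟨_, _, i2.1.2 (by omega), i1.2.2 hm, hb.symm.imp hB hB,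
      by simp only [sqDist]; linarith, Set.inter_comm _ _⟩

theorem checks_g_iff {d : ℕ} (w : Vertex d → ZMod 2) :
    (∀ S ∈ zSupports d .g, check S w = 0) ↔
      SquareClosed (side d) fun x y z => extend w (x, y, z) := by
  have hr : Colour.r ≠ .g := by decide
  have hbg : Colour.b ≠ .g := by decide
  have hL := side_even d
  constructor
  · intro h
    refine ⟨?_, ?_, ?_⟩ <;> intro x y z hx hy hz hb
    · rw [← check_square_xz hr hr]
      simp only [Box] at hb
      exact check_rb_eq_zero h hx (by omega) hz hx (by omega) hz
        (by simp only [Box]; omega) (by ring) (by omega)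
    · rw [← check_square_yz hr hr]
      simp only [Box] at hb
      exact check_rb_eq_zero h (by omega) (by omega) hz (by omega) (by omega) hz
        (by simp only [Box]; omega) (by ring) (by omega)
    · rw [← check_square_xy hr hr]
      simp only [Box] at hb
      exact check_rb_eq_zero h (by omega) (by omega) (by omega) (by omega) (by omega) (by omega)
        (by simp only [Box]; omega) (by ring) (by omega)
  · intro h S hS
    -- The centre of a horizontal face can lie at `z = -1` or `z = side d + 1`; all its vertices are
    -- then outside the box.
    have hxy : ∀ x y z, x % 2 = 1 → y % 2 = 1 → z % 2 = 1 →
        0 ≤ x ∧ x ≤ side d ∧ 0 ≤ y ∧ y ≤ side d →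
        extend w (x + 1, y, z) + extend w (x - 1, y, z) + extend w (x, y + 1, z) +
          extend w (x, y - 1, z) = 0 := by
      intro x y z hx hy hz hin
      by_cases hb : Box (side d) x y z
      · exact h.xy x y z hx hy hz hb
      · simp only [Box] at hb
        rw [extend_out w, extend_out w, extend_out w, extend_out w]
        · rfl
        all_goals
          simp only [Box]
          omega
    obtain ⟨-, ⟨x, y, z⟩, ⟨x', y', z'⟩, hp, hq, hb, hdist, rfl⟩ := hS
    simp only [IsCentre, Int.odd_iff, Int.even_iff] at hp hq
    simp only [InBox] at hb
    simp only [sqDist] at hdist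
    obtain ⟨i, hi⟩ : ∃ i, x' = x + 2 * i := ⟨(x' - x) / 2, by omega⟩
    obtain ⟨j, hj⟩ : ∃ j, y' = y + 2 * j := ⟨(y' - y) / 2, by omega⟩
    obtain ⟨k, hk⟩ : ∃ k, z' = z + 2 * k := ⟨(z' - z) / 2, by omega⟩
    subst hi hj hk
    have hs : i ^ 2 + j ^ 2 + k ^ 2 = 1 := by linarith
    have b := bounds_of_sq_add hs (by norm_num)
    have hi : i = -1 ∨ i = 0 ∨ i = 1 := by omega
    have hj : j = -1 ∨ j = 0 ∨ j = 1 := by omega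
    have hk : k = -1 ∨ k = 0 ∨ k = 1 := by omega
    have cases6 : (j = 0 ∧ k = 0 ∧ (i = 1 ∨ i = -1)) ∨ (i = 0 ∧ k = 0 ∧ (j = 1 ∨ j = -1)) ∨
        (i = 0 ∧ j = 0 ∧ (k = 1 ∨ k = -1)) := by
      rcases hi with rfl | rfl | rfl <;> rcases hj with rfl | rfl | rfl <;>
        rcases hk with rfl | rfl | rfl <;> omega
    clear hi hj hk b hs hdist
    rcases cases6 with ⟨rfl, rfl, rfl | rfl⟩ | ⟨rfl, rfl, rfl | rfl⟩ | ⟨rfl, rfl, rfl | rfl⟩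
    · have t := check_square_yz (x := x + 1) (y := y) (z := z) hbg hr w
      rw [h.yz _ _ _ (by omega) (by omega) (by omega) (by simp only [Box]; omega), Set.inter_comm]
        at t
      simpa [add_assoc] using t
    · have t := check_square_yz (x := x - 1) (y := y) (z := z) hr hbg w
      rw [h.yz _ _ _ (by omega) (by omega) (by omega) (by simp only [Box]; omega)] at t
      rw [show x + 2 * -1 = x - 1 - 1 by ring]
      simpa using t
    · have t := check_square_xz (x := x) (y := y + 1) (z := z) hbg hr w
      rw [h.xz _ _ _ (by omega) (by omega) (by omega) (by simp only [Box]; omega), Set.inter_comm]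
        at t
      simpa [add_assoc] using t
    · have t := check_square_xz (x := x) (y := y - 1) (z := z) hr hbg w
      rw [h.xz _ _ _ (by omega) (by omega) (by omega) (by simp only [Box]; omega)] at t
      rw [show y + 2 * -1 = y - 1 - 1 by ring]
      simpa using t
    · have t := check_square_xy (x := x) (y := y) (z := z + 1) hbg hr w
      rw [hxy _ _ _ (by omega) (by omega) (by omega) (by omega), Set.inter_comm] at t
      simpa [add_assoc] using t
    · have t := check_square_xy (x := x) (y := y) (z := z - 1) hr hbg w
      rw [hxy _ _ _ (by omega) (by omega) (by omega) (by omega)] at t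
      rw [show z + 2 * -1 = z - 1 - 1 by ring]
      simpa using t

theorem octNbr_single {L x y z u1 u2 u3 : ℤ} (hp : OctCell L x y z)
    (hu : u3 % 2 = 0 ∧ u1 % 2 = 0 ∧ u2 % 2 = 0 ∨ u3 % 2 = 1 ∧ (u1 + u2) % 2 = 1) :
    octNbr (fun a b c => if a = x ∧ b = y ∧ c = z then 1 else 0) u1 u2 u3 =
      if (u1 - x) ^ 2 + (u2 - y) ^ 2 + (u3 - z) ^ 2 = 1 then 1 else 0 := by
  obtain ⟨p1, p2, p3, -⟩ := hp
  have far : ∀ i j k : ℤ, i ^ 2 + j ^ 2 + k ^ 2 = 1 →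
      ¬ (u1 - x) ^ 2 + (u2 - y) ^ 2 + (u3 - z) ^ 2 = 1 →
      ¬ (u1 + i = x ∧ u2 + j = y ∧ u3 + k = z) := by
    rintro i j k hs h ⟨rfl, rfl, rfl⟩
    apply h
    rw [← hs]; ring
  rw [octNbr]
  by_cases h : (u1 - x) ^ 2 + (u2 - y) ^ 2 + (u3 - z) ^ 2 = 1
  · have b := bounds_of_sq_add h (by norm_num)
    rw [if_pos h]
    obtain ⟨i, rfl⟩ : ∃ i, u1 = x + i := ⟨u1 - x, by ring⟩
    obtain ⟨j, rfl⟩ : ∃ j, u2 = y + j := ⟨u2 - y, by ring⟩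
    obtain ⟨k, rfl⟩ : ∃ k, u3 = z + k := ⟨u3 - z, by ring⟩
    simp only [add_sub_cancel_left] at h b
    have hi : i = -1 ∨ i = 0 ∨ i = 1 := by omega
    have hj : j = -1 ∨ j = 0 ∨ j = 1 := by omega
    have hk : k = -1 ∨ k = 0 ∨ k = 1 := by omega
    have cases6 : (j = 0 ∧ k = 0 ∧ (i = 1 ∨ i = -1)) ∨ (i = 0 ∧ k = 0 ∧ (j = 1 ∨ j = -1)) ∨
        (i = 0 ∧ j = 0 ∧ (k = 1 ∨ k = -1)) := by
      rcases hi with rfl | rfl | rfl <;> rcases hj with rfl | rfl | rfl <;>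
        rcases hk with rfl | rfl | rfl <;> omega
    clear hi hj hk b h far
    split_ifs <;> first | rfl | (exfalso; omega)
  · rw [if_neg h]
    split_ifs <;> first | rfl | skip
    all_goals exfalso
    all_goals first
      | exact far 1 0 0 (by norm_num) h (by omega)
      | exact far (-1) 0 0 (by norm_num) h (by omega)
      | exact far 0 1 0 (by norm_num) h (by omega)
      | exact far 0 (-1) 0 (by norm_num) h (by omega)
      | exact far 0 0 1 (by norm_num) h (by omega)
      | exact far 0 0 (-1) (by norm_num) h (by omega)

theorem isCell_g {d : ℕ} (x y z : ℤ) : IsCell d .g (x, y, z) ↔ OctCell (side d) x y z :=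
  isCell_g_orient .g x y z

theorem binVec_oct {d : ℕ} {x y z u1 u2 u3 : ℤ}
    (hp : OctCell (side d) x y z) (hu : (u1, u2, u3) ∈ siteFinset d) :
    binVec d (cellSupport d .g (x, y, z)) ⟨(u1, u2, u3), hu⟩ =
      octNbr (fun a b c => if a = x ∧ b = y ∧ c = z then 1 else 0) u1 u2 u3 := by
  rw [octNbr_single hp (mem_siteFinset.1 hu).2]
  simp [binVec, Set.indicator_apply, cellSupport, sqDist, sqRadius]

theorem check_oct_cell {d : ℕ} {p : Point} (hp : IsCell d .g p)
    {S : Set (Vertex d)} (hS : S ∈ zSupports d .g) :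
    check S (binVec d (cellSupport d .g p)) = 0 := by
  obtain ⟨x, y, z⟩ := p
  rw [isCell_g] at hp
  refine (checks_g_iff _).2 ?_ S hS
  have key := squareClosed_octNbr (side_even d)
    (f := fun a b c => if a = x ∧ b = y ∧ c = z then 1 else 0) (by
      rintro a b c' h
      refine if_neg ?_
      rintro ⟨rfl, rfl, rfl⟩
      exact h hp)
  refine key.congr ?_
  intro u1 u2 u3 hu
  split_ifs with hb
  · have hm := mem_siteFinset.2 ⟨hb, hu⟩
    rw [extend, dif_pos hm, binVec_oct hp]
  · exact extend_out _ hb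

theorem binVec_boundary_g {d : ℕ} (s : Bool) {u1 u2 u3 : ℤ}
    (hu : (u1, u2, u3) ∈ siteFinset d) :
    binVec d (boundary d .g s) ⟨(u1, u2, u3), hu⟩ =
      if u3 = if s then side d else 0 then 1 else 0 := by
  have h : ((⟨(u1, u2, u3), hu⟩ : Vertex d) ∈ boundary d .g s) ↔
      u3 = if s then side d else 0 := Iff.rfl
  classical
  rw [binVec, Set.indicator_apply]
  simp only [h, Pi.one_apply]

theorem check_oct_boundary {d : ℕ} (s : Bool) {S : Set (Vertex d)} (hS : S ∈ zSupports d .g) :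
    check S (binVec d (boundary d .g s)) = 0 := by
  refine (checks_g_iff _).2 ?_ S hS
  have key := squareClosed_boundary (t := if s then side d else 0) (side_even d)
    (by cases s <;> simp)
  refine key.congr ?_
  intro u1 u2 u3 hu
  by_cases hb : Box (side d) u1 u2 u3
  · have hm := mem_siteFinset.2 ⟨hb, hu⟩
    rw [if_pos hb, extend, dif_pos hm, binVec_boundary_g]
  · rw [if_neg hb]
    exact extend_out _ hb

theorem octNbr_sum {ι : Type*} (T : Finset ι) (F : ι → ℤ → ℤ → ℤ → ZMod 2) (a : ι → ZMod 2)
    (x y z : ℤ) :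
    octNbr (fun i j k => ∑ p ∈ T, a p * F p i j k) x y z = ∑ p ∈ T, a p * octNbr (F p) x y z := by
  simp only [octNbr]
  split_ifs <;> simp only [mul_add, Finset.sum_add_distrib]

theorem exists_xSpan_add_oct {d : ℕ}
    {w : Vertex d → ZMod 2} (hw : ∀ S ∈ zSupports d .g, check S w = 0) :
    ∃ a : ZMod 2, ∃ h ∈ xSpan d .g, w = a • binVec d (boundary d .g true) + h := by
  classical
  have hW := (checks_g_iff w).1 hw
  obtain ⟨f, a, hf, heq⟩ := hW.exists_primitive (fun x y z h => extend_out w h) (side_even d)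
  let I := Finset.Icc 0 (side d)
  let T : Finset Point := (I ×ˢ I ×ˢ I).filter fun p => OctCell (side d) p.1 p.2.1 p.2.2
  have hT : ∀ x y z, (x, y, z) ∈ T ↔ OctCell (side d) x y z := by
    intro x y z
    simp only [T, I, Finset.mem_filter, Finset.mem_product, Finset.mem_Icc, and_iff_right_iff_imp]
    rintro ⟨_, _, _, _, h⟩
    omega
  refine ⟨a, ∑ p ∈ T, f p.1 p.2.1 p.2.2 • binVec d (cellSupport d .g p), ?_, ?_⟩
  · refine Submodule.sum_mem _ fun p hp => Submodule.smul_mem _ _ (Submodule.subset_span ?_)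
    exact ⟨_, ⟨_, (isCell_g _ _ _).2 ((hT _ _ _).1 hp), rfl⟩, rfl⟩
  · have hf' : f = fun i j k => ∑ p ∈ T, f p.1 p.2.1 p.2.2 *
        (fun (p : Point) a b c => if a = p.1 ∧ b = p.2.1 ∧ c = p.2.2 then 1 else 0) p i j k := by
      funext i j k
      by_cases h : OctCell (side d) i j k
      · rw [Finset.sum_eq_single (i, j, k)]
        · simp
        · intro p _ hne
          have : ¬ (i = p.1 ∧ j = p.2.1 ∧ k = p.2.2) := by
            rintro ⟨rfl, rfl, rfl⟩; exact hne rfl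
          simp [this]
        · intro h'; exact absurd ((hT _ _ _).2 h) h'
      · rw [hf _ _ _ h]
        symm
        refine Finset.sum_eq_zero fun p hp => ?_
        have : ¬ (i = p.1 ∧ j = p.2.1 ∧ k = p.2.2) := by
          rintro ⟨rfl, rfl, rfl⟩; exact h ((hT _ _ _).1 hp)
        simp [this]
    funext ⟨⟨u1, u2, u3⟩, hv⟩
    have ⟨hb, hu⟩ := mem_siteFinset.1 hv
    have h := heq u1 u2 u3 hb hu
    rw [extend, dif_pos hv] at h
    rw [h, hf', octNbr_sum, add_comm, Pi.add_apply, Finset.sum_apply]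
    congr 1
    · simp [binVec_boundary_g]
    · refine Finset.sum_congr rfl fun p hp => ?_
      rw [Pi.smul_apply, smul_eq_mul, ← binVec_oct ((hT _ _ _).1 hp) hv]
      congr 1
      rw [← hf']

/-! ### All colours together -/

theorem check_boundary {d : ℕ} (c : Colour) (s : Bool) {S : Set (Vertex d)}
    (hS : S ∈ zSupports d c) : check S (binVec d (boundary d c s)) = 0 := by
  by_cases hc : c = .g
  · subst hc; exact check_oct_boundary s hS
  · exact check_cub_boundary hc s hS

theorem check_xSpan {d : ℕ} {c : Colour} {x : Vertex d → ZMod 2} (hx : x ∈ xSpan d c)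
    {S : Set (Vertex d)} (hS : S ∈ zSupports d c) : check S x = 0 := by
  induction hx using Submodule.span_induction with
  | mem x hx =>
    obtain ⟨_, ⟨p, hp, rfl⟩, rfl⟩ := hx
    by_cases hc : c = .g
    · subst hc; exact check_oct_cell hp hS
    · exact check_cub_cell hc hp hS
  | zero => simp [check]
  | add x y _ _ hx hy => rw [check_add, hx, hy, add_zero]
  | smul a x _ hx => rw [check_smul, hx, mul_zero]

theorem exists_xSpan_add {d : ℕ} (hd : 2 ≤ d) {c : Colour}
    {w : Vertex d → ZMod 2} (hw : ∀ S ∈ zSupports d c, check S w = 0) :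
    ∃ a : ZMod 2, ∃ h ∈ xSpan d c, w = a • binVec d (boundary d c true) + h := by
  by_cases hc : c = .g
  · subst hc; exact exists_xSpan_add_oct hw
  · exact exists_xSpan_add_cub hd hc hw

/-! ### Collisions -/

theorem prod_colour {M : Type*} [CommMonoid M] (f : Colour → M) :
    ∏ c, f c = f .r * f .g * f .b := by
  have : (Finset.univ : Finset Colour) = {.r, .g, .b} := rfl
  rw [this, Finset.prod_insert (by decide), Finset.prod_pair (by decide), mul_assoc]

/-- Number of common ones of three binary vectors, modulo two. -/
noncomputable def triple {d : ℕ} (t u v : Vertex d → ZMod 2) : ZMod 2 := ∑ w, t w * u w * v w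

theorem triple_comm₁₂ {d : ℕ} (t u v : Vertex d → ZMod 2) : triple t u v = triple u t v :=
  Finset.sum_congr rfl fun _ _ => by ring

theorem triple_comm₂₃ {d : ℕ} (t u v : Vertex d → ZMod 2) : triple t u v = triple t v u :=
  Finset.sum_congr rfl fun _ _ => by ring

theorem triple_add {d : ℕ} (t t' u v : Vertex d → ZMod 2) :
    triple (t + t') u v = triple t u v + triple t' u v := by
  simp [triple, add_mul, Finset.sum_add_distrib]

theorem triple_smul {d : ℕ} (a : ZMod 2) (t u v : Vertex d → ZMod 2) :
    triple (a • t) u v = a * triple t u v := by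
  simp [triple, Finset.mul_sum, mul_assoc]

theorem binVec_apply {d : ℕ} (S : Set (Vertex d)) (v : Vertex d) [Decidable (v ∈ S)] :
    binVec d S v = if v ∈ S then 1 else 0 := by
  rw [binVec, Set.indicator_apply]; rfl

theorem triple_binVec {d : ℕ} (S T : Set (Vertex d)) (v : Vertex d → ZMod 2) :
    triple (binVec d S) (binVec d T) v = check (S ∩ T) v := by
  classical
  refine Finset.sum_congr rfl fun w _ => ?_
  simp only [binVec_apply, Set.mem_inter_iff]
  by_cases h : w ∈ S <;> by_cases h' : w ∈ T <;> simp [h, h']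

theorem triple_binVec₃ {d : ℕ} (S T U : Set (Vertex d)) :
    triple (binVec d S) (binVec d T) (binVec d U) = check (S ∩ T ∩ U) 1 := by
  classical
  refine Finset.sum_congr rfl fun w _ => ?_
  simp only [binVec_apply, Set.mem_inter_iff]
  by_cases h : w ∈ S <;> by_cases h' : w ∈ T <;> by_cases h'' : w ∈ U <;> simp [h, h', h'']

theorem triple_xSpan {d : ℕ} {c : Colour} {h u v : Vertex d → ZMod 2} (hh : h ∈ xSpan d c)
    (H : ∀ p, IsCell d c p → triple (binVec d (cellSupport d c p)) u v = 0) :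
    triple h u v = 0 := by
  induction hh using Submodule.span_induction with
  | mem x hx => obtain ⟨_, ⟨p, hp, rfl⟩, rfl⟩ := hx; exact H p hp
  | zero => simp [triple]
  | add x y _ _ hx hy => rw [triple_add, hx, hy, add_zero]
  | smul a x _ hx => rw [triple_smul, hx, mul_zero]

/-- The binary vectors which satisfy all the `Z` checks of a code. -/
def IsClosedVec (d : ℕ) (c : Colour) (w : Vertex d → ZMod 2) : Prop :=
  ∀ S ∈ zSupports d c, check S w = 0

/-- A common vertex is within 1 of both centres in every coordinate, and the centres differ in
parity in every coordinate. All differences are thus 1 or -1, and the overlap is a `Z` check. An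
empty overlap contributes zero. -/
theorem check_cub_oct {d : ℕ} {c : Colour} (hc : c ≠ .g) {p q : Point}
    (hp : IsCell d (opposite c) p) (hq : IsCell d .g q) {w : Vertex d → ZMod 2}
    (hw : IsClosedVec d c w) :
    check (cellSupport d (opposite c) p ∩ cellSupport d .g q) w = 0 := by
  by_contra hne
  obtain ⟨⟨v, hv⟩, hvp, hvq⟩ := nonempty_of_check_ne_zero hne
  refine hne (hw _ ((mem_zSupports_cub hc).2 ⟨p, q, hp, hq, ?_, rfl⟩))
  obtain ⟨x, y, z, rfl⟩ := exists_orient c p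
  obtain ⟨x', y', z', rfl⟩ := exists_orient c q
  obtain ⟨u1, u2, u3, rfl⟩ := exists_orient c v
  have hg : sqRadius .g = 1 := rfl
  simp only [cellSupport, Set.mem_ofPred_eq, sqDist_orient_mk, sqRadius_opposite hc, hg]
    at hvp hvq
  rw [isCell_opposite_orient hc] at hp
  rw [isCell_g_orient] at hq
  obtain ⟨p1, p2, p3, -⟩ := hp
  obtain ⟨q1, q2, q3, -⟩ := hq
  have b1 := bounds_of_sq_add hvp (by norm_num)
  have b2 := bounds_of_sq_add hvq (by norm_num)
  rw [sqDist_orient_mk]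
  have e1 : x - x' = 1 ∨ x - x' = -1 := by omega
  have e2 : y - y' = 1 ∨ y - y' = -1 := by omega
  have e3 : z - z' = 1 ∨ z - z' = -1 := by omega
  rcases e1 with e1 | e1 <;> rcases e2 with e2 | e2 <;> rcases e3 with e3 | e3 <;>
    rw [e1, e2, e3] <;> norm_num

theorem sq_add_of_even_differences {i j k : ℤ} (hi : i = 0 ∨ i = 2 ∨ i = -2)
    (hj : j = 0 ∨ j = 2 ∨ j = -2) (hk : k = 0 ∨ k = 2 ∨ k = -2) (h0 : i = 0 ∨ j = 0 ∨ k = 0)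
    (hr : (i + j + k) % 4 = 2) : i ^ 2 + j ^ 2 + k ^ 2 = 4 ∧ (i = 0 ∨ j = 0) := by
  rcases hi with rfl | rfl | rfl <;> rcases hj with rfl | rfl | rfl <;>
    rcases hk with rfl | rfl | rfl <;> revert h0 hr <;> decide

/-- By parity, a common vertex has a coordinate that it shares with both centres. The other
differences are 0 or ±2, and the residues of the two colours leave exactly one nonzero difference.
The overlap is therefore a square face. -/
theorem check_cub_cub {d : ℕ} {p q : Point} (hp : IsCell d .r p) (hq : IsCell d .b q)
    {w : Vertex d → ZMod 2} (hw : IsClosedVec d .g w) :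
    check (cellSupport d .r p ∩ cellSupport d .b q) w = 0 := by
  by_contra hne
  obtain ⟨⟨⟨u1, u2, u3⟩, hv⟩, hvp, hvq⟩ := nonempty_of_check_ne_zero hne
  obtain ⟨x, y, z⟩ := p
  obtain ⟨x', y', z'⟩ := q
  have hL := side_even d
  have hu := (mem_siteFinset.1 hv).2
  simp only [cellSupport, Set.mem_ofPred_eq, sqDist, sqRadius] at hvp hvq
  obtain ⟨hp, hpb⟩ := hp
  obtain ⟨hq, hqb⟩ := hq
  simp only [IsCentre, Int.odd_iff, Int.even_iff] at hp hq
  obtain ⟨p1, p2, p3, pr⟩ := hp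
  obtain ⟨q1, q2, q3, qr⟩ := hq
  have b1 := bounds_of_sq_add hvp (by norm_num)
  have b2 := bounds_of_sq_add hvq (by norm_num)
  have hr : (x + y + z - x' - y' - z') % 4 = 2 := by omega
  have h0 : x - x' = 0 ∨ y - y' = 0 ∨ z - z' = 0 := by
    rcases hu with ⟨h1, h2, h3⟩ | ⟨h1, h2⟩
    · exact Or.inr (Or.inr (by omega))
    · rcases (by omega : u1 % 2 = 0 ∨ u2 % 2 = 0) with h | h
      · exact Or.inr (Or.inl (by omega))
      · exact Or.inl (by omega)
  have dist := sq_add_of_even_differences (by omega) (by omega) (by omega) h0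
    (show (x - x' + (y - y') + (z - z')) % 4 = 2 by omega)
  have hcell : cellSupport d .b (x', y', z') = cellSupport d .r (x', y', z') := by
    simp only [cellSupport, sqRadius]
  rw [hcell] at hne
  refine hne (check_rb_eq_zero hw p1 p2 p3 q1 q2 q3 ?_ ?_ hr)
  · simp only [InBox, IsFlattened] at hpb hqb
    simp only [Box]
    clear hvp hvq b1 b2 hu hr pr qr h0
    rcases hpb with hpb | hpb
    · exact Or.inl (by omega)
    · rcases hqb with hqb | hqb
      · exact Or.inr (by omega)
      -- A flattened `r`-cell leaves the box in y and a flattened `b`-cell in x, so two of them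
      -- would differ in both coordinates.
      · exfalso
        have hx : x - x' ≠ 0 := by omega
        have hy : y - y' ≠ 0 := by omega
        exact dist.2.elim hx hy
  · exact dist.1

/-- The coordinate of a boundary. -/
def level (d : ℕ) (s : Bool) : ℤ := if s then side d else 0

theorem level_eq (d : ℕ) (s : Bool) : level d s = 0 ∨ level d s = side d := by
  cases s <;> simp [level]

theorem mem_boundary {d : ℕ} {c : Colour} {s : Bool} {v : Vertex d} :
    v ∈ boundary d c s ↔ axis c v.1 = level d s := Iff.rfl

theorem axis_opposite_orient {c : Colour} (hc : c ≠ .g) (x y z : ℤ) :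
    axis (opposite c) (orient c (x, y, z)) = x := by
  cases c
  · rfl
  · exact absurd rfl hc
  · rfl

theorem axis_g_orient (c : Colour) (x y z : ℤ) : axis .g (orient c (x, y, z)) = z := by
  cases c <;> rfl

theorem extend_one {d : ℕ} {p : Point} (hp : p ∈ siteFinset d) :
    extend (1 : Vertex d → ZMod 2) p = 1 := dif_pos hp

/-- In oriented coordinates the two boundaries cross in a line parallel to the y-axis. If the cell
meets it, it does so at `y + 1` and `y - 1`, both in the box because `y` is odd and lies between 0
and the even side. -/
theorem triple_cub_boundaries {d : ℕ} {c : Colour} (hc : c ≠ .g) {p : Point}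
    (hp : IsCell d c p) (s s' : Bool) :
    triple (binVec d (cellSupport d c p)) (binVec d (boundary d (opposite c) s))
      (binVec d (boundary d .g s')) = 0 := by
  rw [triple_binVec₃]
  obtain ⟨x, y, z, rfl⟩ := exists_orient c p
  rw [isCell_orient hc] at hp
  have hp' := hp
  simp only [CubCell] at hp'
  have hL := side_even d
  have hs := level_eq d s
  have hs' := level_eq d s'
  by_contra hne
  obtain ⟨⟨v, hv⟩, ⟨hvp, hvs⟩, hvs'⟩ := nonempty_of_check_ne_zero hne
  obtain ⟨u1, u2, u3, rfl⟩ := exists_orient c v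
  simp only [cellSupport, Set.mem_ofPred_eq, sqDist_orient_mk, sqRadius_cub hc] at hvp
  rw [mem_boundary] at hvs hvs'
  simp only [axis_opposite_orient hc, axis_g_orient] at hvs hvs'
  have b := bounds_of_sq_add hvp (by norm_num)
  have hu := (orient_mem_siteFinset.1 hv).2
  refine hne ?_
  rw [check_eq_sum (T := {orient c (u1, y + 1, u3), orient c (u1, y - 1, u3)}),
    Finset.sum_pair, extend_one, extend_one]
  · rfl
  · rw [orient_mem_siteFinset]
    simp only [Box]
    omega
  · rw [orient_mem_siteFinset]
    simp only [Box]
    omega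
  · rw [(orient_injective c).ne_iff]
    simp only [ne_eq, Prod.mk.injEq]
    omega
  · rintro ⟨v', hv'⟩
    obtain ⟨w1, w2, w3, rfl⟩ := exists_orient c v'
    simp only [cellSupport, Set.mem_inter_iff, Set.mem_ofPred_eq, sqDist_orient_mk,
      sqRadius_cub hc, mem_boundary, axis_opposite_orient hc, axis_g_orient, Finset.mem_insert,
      Finset.mem_singleton, (orient_injective c).eq_iff, Prod.mk.injEq, ← hvs, ← hvs']
    have hx : u1 - x = 1 ∨ u1 - x = -1 := by omega
    have hz : u3 - z = 0 := by omega
    constructor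
    · rintro ⟨⟨h, rfl⟩, rfl⟩
      have b' := bounds_of_sq_add h (by norm_num)
      have hw := (orient_mem_siteFinset.1 hv').2
      omega
    · rintro (⟨rfl, rfl, rfl⟩ | ⟨rfl, rfl, rfl⟩) <;> refine ⟨⟨?_, rfl⟩, rfl⟩ <;>
        rcases hx with hx | hx <;> rw [hx, hz] <;> ring

/-- The line where the two boundaries cross is vertical. An octahedron that meets it is centred on
it and contributes its top and bottom vertices. -/
theorem triple_oct_boundaries {d : ℕ} {p : Point} (hp : IsCell d .g p) (s s' : Bool) :
    triple (binVec d (cellSupport d .g p)) (binVec d (boundary d .r s))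
      (binVec d (boundary d .b s')) = 0 := by
  rw [triple_binVec₃]
  obtain ⟨x, y, z⟩ := p
  rw [isCell_g] at hp
  have hp' := hp
  simp only [OctCell, Box] at hp'
  have hL := side_even d
  have hs := level_eq d s
  have hs' := level_eq d s'
  by_contra hne
  obtain ⟨⟨⟨u1, u2, u3⟩, hv⟩, ⟨hvp, hvs⟩, hvs'⟩ := nonempty_of_check_ne_zero hne
  simp only [cellSupport, Set.mem_ofPred_eq, sqDist, sqRadius] at hvp
  rw [mem_boundary] at hvs hvs'
  simp only [axis] at hvs hvs'
  have b := bounds_of_sq_add hvp (by norm_num)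
  have hu := (mem_siteFinset.1 hv).2
  refine hne ?_
  have hx : u1 - x = 0 := by omega
  have hy : u2 - y = 0 := by omega
  rw [check_eq_sum (T := {(u1, u2, z + 1), (u1, u2, z - 1)}),
    Finset.sum_pair, extend_one, extend_one]
  · rfl
  · rw [mem_siteFinset]
    simp only [Box]
    omega
  · rw [mem_siteFinset]
    simp only [Box]
    omega
  · simp only [ne_eq, Prod.mk.injEq]
    omega
  · rintro ⟨⟨w1, w2, w3⟩, hv'⟩
    simp only [cellSupport, Set.mem_inter_iff, Set.mem_ofPred_eq, sqDist,
      sqRadius, mem_boundary, axis, Finset.mem_insert,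
      Finset.mem_singleton, Prod.mk.injEq, ← hvs, ← hvs']
    constructor
    · rintro ⟨⟨h, rfl⟩, rfl⟩
      have b' := bounds_of_sq_add h (by norm_num)
      have hw := (mem_siteFinset.1 hv').2
      omega
    · rintro (⟨rfl, rfl, rfl⟩ | ⟨rfl, rfl, rfl⟩) <;> refine ⟨⟨?_, rfl⟩, rfl⟩ <;>
        rw [hx, hy] <;> ring

theorem triple_boundaries {d : ℕ} (hd : 2 ≤ d) (s s' s'' : Bool) :
    triple (binVec d (boundary d .r s)) (binVec d (boundary d .g s'))
      (binVec d (boundary d .b s'')) = 1 := by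
  have hL := side_even d
  have hL2 := two_le_side hd
  have h := level_eq d s
  have h' := level_eq d s'
  have h'' := level_eq d s''
  rw [triple_binVec₃, check_eq_sum (T := {(level d s, level d s'', level d s')}),
    Finset.sum_singleton, extend_one]
  · rw [mem_siteFinset]
    simp only [Box]
    omega
  · rintro ⟨⟨w1, w2, w3⟩, hv'⟩
    simp only [Set.mem_inter_iff, mem_boundary, axis, Finset.mem_singleton, Prod.mk.injEq]
    tauto

theorem isClosedVec_boundary (d : ℕ) (c : Colour) (s : Bool) :
    IsClosedVec d c (binVec d (boundary d c s)) := fun _ => check_boundary c s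

theorem isClosedVec_xSpan {d : ℕ} {c : Colour} {h : Vertex d → ZMod 2} (hh : h ∈ xSpan d c) :
    IsClosedVec d c h := fun _ => check_xSpan hh

/-- Only closedness is asked of the third vector, so the case of a logical boundary and the case of
a third stabilizer are covered together. -/
theorem triple_rg {d : ℕ} {t u v : Vertex d → ZMod 2} (ht : t ∈ xSpan d .r)
    (hu : u ∈ xSpan d .g) (hv : IsClosedVec d .b v) : triple t u v = 0 := by
  refine triple_xSpan ht fun p hp => ?_
  rw [triple_comm₁₂]
  refine triple_xSpan hu fun q hq => ?_
  rw [triple_comm₁₂, triple_binVec]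
  exact check_cub_oct (c := .b) (by decide) hp hq hv

theorem triple_gb {d : ℕ} {t u v : Vertex d → ZMod 2} (ht : IsClosedVec d .r t)
    (hu : u ∈ xSpan d .g) (hv : v ∈ xSpan d .b) : triple t u v = 0 := by
  rw [triple_comm₁₂, triple_comm₂₃]
  refine triple_xSpan hu fun q hq => ?_
  rw [triple_comm₁₂]
  refine triple_xSpan hv fun p hp => ?_
  rw [triple_binVec]
  exact check_cub_oct (c := .r) (by decide) hp hq ht

theorem triple_rb {d : ℕ} {t u v : Vertex d → ZMod 2} (ht : t ∈ xSpan d .r)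
    (hu : IsClosedVec d .g u) (hv : v ∈ xSpan d .b) : triple t u v = 0 := by
  rw [triple_comm₂₃]
  refine triple_xSpan ht fun p hp => ?_
  rw [triple_comm₁₂]
  refine triple_xSpan hv fun q hq => ?_
  rw [triple_comm₁₂, triple_binVec]
  exact check_cub_cub hp hq hu

theorem triple_coset {d : ℕ} (hd : 2 ≤ d) (s : Colour → Bool) {a : Colour → ZMod 2}
    {x : Colour → Vertex d → ZMod 2} (hx : ∀ c, x c ∈ xCoset d s c (a c)) :
    triple (x .r) (x .g) (x .b) = a .r * a .g * a .b := by
  obtain ⟨t, ht, hr⟩ := hx .r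
  obtain ⟨u, hu, hg⟩ := hx .g
  obtain ⟨v, hv, hb⟩ := hx .b
  have add₂ : ∀ t u u' v : Vertex d → ZMod 2, triple t (u + u') v =
      triple t u v + triple t u' v := by
    intro t u u' v
    rw [triple_comm₁₂, triple_add, triple_comm₁₂, triple_comm₁₂ u']
  have add₃ : ∀ t u v v' : Vertex d → ZMod 2, triple t u (v + v') =
      triple t u v + triple t u v' := by
    intro t u v v'
    rw [triple_comm₂₃, add₂, triple_comm₂₃, triple_comm₂₃ t v']
  have smul₂ : ∀ (a : ZMod 2) (t u v : Vertex d → ZMod 2), triple t (a • u) v =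
      a * triple t u v := by
    intro a t u v
    rw [triple_comm₁₂, triple_smul, triple_comm₁₂]
  have smul₃ : ∀ (a : ZMod 2) (t u v : Vertex d → ZMod 2), triple t u (a • v) =
      a * triple t u v := by
    intro a t u v
    rw [triple_comm₂₃, smul₂, triple_comm₂₃]
  have k1 : triple t (binVec d (boundary d .g (s .g))) (binVec d (boundary d .b (s .b))) = 0 := by
    rw [triple_comm₂₃]
    exact triple_xSpan ht fun p hp => triple_cub_boundaries (c := .r) (by decide) hp _ _
  have k2 : triple (binVec d (boundary d .r (s .r))) u (binVec d (boundary d .b (s .b))) = 0 := by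
    rw [triple_comm₁₂]
    exact triple_xSpan hu fun p hp => triple_oct_boundaries hp _ _
  have k3 : triple (binVec d (boundary d .r (s .r))) (binVec d (boundary d .g (s .g))) v = 0 := by
    rw [triple_comm₂₃, triple_comm₁₂]
    exact triple_xSpan hv fun p hp => triple_cub_boundaries (c := .b) (by decide) hp _ _
  have hX := isClosedVec_boundary d
  rw [hr, hg, hb]
  -- Of the eight terms of the expansion, only the one with three boundaries survives.
  simp only [triple_add, triple_smul, add₂, add₃, smul₂, smul₃, k1, k2, k3, triple_boundaries hd,
    triple_rg ht hu (hX _ _), triple_rg ht hu (isClosedVec_xSpan hv), triple_gb (hX _ _) hu hv,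
    triple_rb ht (hX _ _) hv]
  ring

/-! ### Closed vectors and the two cosets of a code -/

theorem boundary_mem_xCoset (d : ℕ) (s : Colour → Bool) (c : Colour) :
    binVec d (boundary d c (s c)) ∈ xCoset d s c 1 := ⟨0, Submodule.zero_mem _, by simp⟩

/-- With logical boundaries, whose labels are 1, in the two other slots, `triple_coset` evaluates to
the label of `x`. The label is thus determined by `x`. -/
theorem xCoset_unique {d : ℕ} (hd : 2 ≤ d) {s : Colour → Bool} {c : Colour} {a b : ZMod 2}
    {x : Vertex d → ZMod 2} (ha : x ∈ xCoset d s c a) (hb : x ∈ xCoset d s c b) : a = b := by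
  have key : ∀ a, x ∈ xCoset d s c a → ∀ c', Function.update
      (fun c' => binVec d (boundary d c' (s c'))) c x c' ∈
        xCoset d s c' (Function.update (fun _ => (1 : ZMod 2)) c a c') := by
    intro a ha c'
    by_cases h : c' = c
    · subst h; simpa using ha
    · simpa [h] using boundary_mem_xCoset d s c'
  have e := (triple_coset hd s (key a ha)).symm.trans (triple_coset hd s (key b hb))
  cases c <;> simpa [Function.update] using e

theorem exists_mem_xCoset {d : ℕ} (hd : 2 ≤ d) (s : Colour → Bool) {c : Colour}
    {w : Vertex d → ZMod 2} (hw : IsClosedVec d c w) : ∃ a, w ∈ xCoset d s c a := by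
  obtain ⟨a, h, hh, rfl⟩ := exists_xSpan_add hd hw
  cases hs : s c
  -- Exactness refers to the far boundary. Decomposing the near one has coefficient 1, since
  -- otherwise it would lie in both cosets; the two boundaries are therefore equivalent modulo
  -- stabilizers.
  · obtain ⟨a', h', hh', e⟩ := exists_xSpan_add hd (isClosedVec_boundary d c false)
    have ha' : a' = 1 := by
      rcases (by decide : ∀ a : ZMod 2, a = 0 ∨ a = 1) a' with rfl | rfl
      · have h0 : binVec d (boundary d c false) ∈ xCoset d (fun _ => false) c 0 :=
          ⟨h', hh', by simpa using e⟩
        exact absurd (xCoset_unique hd (boundary_mem_xCoset d (fun _ => false) c) h0) (by decide)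
      · rfl
    subst ha'
    refine ⟨a, h - a • h', Submodule.sub_mem _ hh (Submodule.smul_mem _ _ hh'), ?_⟩
    rw [hs, e]
    simp only [one_smul, smul_add]
    abel
  · exact ⟨a, h, hh, by rw [hs]⟩

theorem isClosedVec_of_mem_xCoset {d : ℕ} {s : Colour → Bool} {c : Colour} {a : ZMod 2}
    {x : Vertex d → ZMod 2} (hx : x ∈ xCoset d s c a) : IsClosedVec d c x := by
  obtain ⟨h, hh, rfl⟩ := hx
  intro S hS
  rw [check_add, check_smul, check_boundary c _ hS, check_xSpan hh hS, mul_zero, add_zero]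

theorem prod_eq_ite (y : Colour → ZMod 2) : ∏ c, y c = if ∀ c, y c = 1 then 1 else 0 := by
  split_ifs with h
  · exact Finset.prod_eq_one fun c _ => h c
  · push Not at h
    obtain ⟨c, hc⟩ := h
    exact Finset.prod_eq_zero (Finset.mem_univ c)
      (((by decide : ∀ a : ZMod 2, a = 0 ∨ a = 1) (y c)).resolve_right hc)

/-- The number of collisions of three codewords is odd exactly for the logical state `111`. -/
theorem odd_collisions_iff {d : ℕ} (hd : 2 ≤ d) (s : Colour → Bool) {a : Colour → ZMod 2}
    {x : Colour → Vertex d → ZMod 2} (hx : ∀ c, x c ∈ xCoset d s c (a c)) :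
    Odd (collisions d x) ↔ ∀ c, a c = 1 := by
  have h : ((collisions d x : ℕ) : ZMod 2) = ∏ c, a c := by
    rw [prod_colour, ← triple_coset hd s hx, collisions, Finset.card_filter, Nat.cast_sum]
    refine Finset.sum_congr rfl fun v _ => ?_
    have := (prod_eq_ite fun c => x c v).symm
    rw [prod_colour] at this
    rw [← this]
    push_cast
    rfl
  rw [← ZMod.natCast_eq_one_iff_odd, h, prod_eq_ite]
  split_ifs with h' <;> simp [h']

/-! ### Operators on the stack -/

theorem toEuclideanLin_apply_coord {n : Type} [Fintype n] [DecidableEq n] (M : Matrix n n ℂ)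
    (ψ : EuclideanSpace ℂ n) (x : n) : Matrix.toEuclideanLin M ψ x = ∑ y, M x y * ψ y := by
  simp [Matrix.toLpLin_apply, Matrix.mulVec, dotProduct]

/-- The configuration which is `h` on the qubits of the code `c` and zero elsewhere. -/
def single (d : ℕ) (c : Colour) (h : Vertex d → ZMod 2) : Config d :=
  fun v c' => if c' = c then h v else 0

theorem applyOn_pauliX {d : ℕ} (c : Colour) (S : Set (Vertex d)) (ψ : StackSpace d)
    (x : Config d) : applyOn d pauliX c S ψ x = ψ (x + single d c (binVec d S)) := by
  classical
  rw [applyOn, toEuclideanLin_apply_coord]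
  have entry : ∀ y : Config d, tensorOp (fun v : Vertex d => tensorOp fun c' : Colour =>
      if c' = c ∧ v ∈ S then pauliX else 1) x y =
      if y = x + single d c (binVec d S) then 1 else 0 := by
    intro y
    have pt : ∀ (v : Vertex d) (c' : Colour),
        (if c' = c ∧ v ∈ S then pauliX else 1) (x v c') (y v c') =
          if y v c' = x v c' + single d c (binVec d S) v c' then 1 else 0 := by
      intro v c'
      have flip : ∀ i j : ZMod 2, pauliX i j = if j = i + 1 then 1 else 0 := by
        intro i j
        have : i = j ↔ ¬ j = i + 1 := by revert i j; decide
        simp [pauliX, this]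
      have keep : ∀ i j : ZMod 2, (1 : Matrix (ZMod 2) (ZMod 2) ℂ) i j =
          if j = i then 1 else 0 := by
        intro i j
        simp [Matrix.one_apply, eq_comm]
      simp only [single, binVec_apply]
      by_cases h : c' = c <;> by_cases h' : v ∈ S <;> simp [h, h', flip, keep]
    simp only [tensorOp, Matrix.of_apply, pt, Fintype.prod_ite_zero, Finset.prod_const_one]
    refine if_congr ?_ rfl rfl
    rw [funext_iff]
    exact forall_congr' fun v => (funext_iff (f := y v)).symm
  simp only [entry, ite_mul, one_mul, zero_mul, Finset.sum_ite_eq', Finset.mem_univ, if_true]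

/-- The eigenvalues of the Pauli matrix `Z`. -/
def sign (a : ZMod 2) : ℂ := if a = 0 then 1 else -1

theorem sign_add (a b : ZMod 2) : sign (a + b) = sign a * sign b := by
  have h : ∀ a : ZMod 2, a = 0 ∨ a = 1 := by decide
  have h1 : (1 + 1 : ZMod 2) = 0 := rfl
  rcases h a with rfl | rfl <;> rcases h b with rfl | rfl <;> simp [sign, h1]

theorem sign_sum {ι : Type*} (T : Finset ι) (f : ι → ZMod 2) :
    sign (∑ i ∈ T, f i) = ∏ i ∈ T, sign (f i) := by
  classical
  induction T using Finset.induction_on with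
  | empty => simp [sign]
  | insert i T hi ih => rw [Finset.sum_insert hi, Finset.prod_insert hi, sign_add, ih]

theorem applyOn_pauliZ {d : ℕ} (c : Colour) (S : Set (Vertex d)) (ψ : StackSpace d)
    (x : Config d) : applyOn d pauliZ c S ψ x = sign (check S fun v => x v c) * ψ x := by
  classical
  rw [applyOn, toEuclideanLin_apply_coord]
  have entry : ∀ y : Config d, tensorOp (fun v : Vertex d => tensorOp fun c' : Colour =>
      if c' = c ∧ v ∈ S then pauliZ else 1) x y =
      if y = x then sign (check S fun v => x v c) else 0 := by
    intro y
    have pt : ∀ (v : Vertex d) (c' : Colour),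
        (if c' = c ∧ v ∈ S then pauliZ else 1) (x v c') (y v c') =
          if y v c' = x v c' then (if c' = c then sign (binVec d S v * x v c) else 1) else 0 := by
      intro v c'
      have h0 : sign 0 = 1 := by simp [sign]
      by_cases h : c' = c <;> by_cases h' : v ∈ S <;>
        by_cases e : y v c' = x v c' <;>
        simp_all [pauliZ, binVec_apply, Matrix.one_apply, sign, eq_comm]
    simp only [tensorOp, Matrix.of_apply, pt, Fintype.prod_ite_zero, Finset.prod_ite_eq',
      Finset.mem_univ, if_true, check, sign_sum]
    refine if_congr ?_ rfl rfl
    rw [funext_iff]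
    exact forall_congr' fun v => (funext_iff (f := y v)).symm
  simp only [entry, ite_mul, zero_mul, Finset.sum_ite_eq', Finset.mem_univ, if_true]

/-- An `X` stabilizer translates configurations, so its condition is invariance. A violated `Z`
check gives the sign -1, and an amplitude equal to its own negative is zero. -/
theorem mem_codeSpace {d : ℕ} {ψ : StackSpace d} : ψ ∈ codeSpace d ↔ ∀ c,
    (∀ S ∈ xSupports d c, ∀ x, ψ (x + single d c (binVec d S)) = ψ x) ∧
      ∀ x : Config d, ¬ IsClosedVec d c (fun v => x v c) → ψ x = 0 := by
  simp only [codeSpace, Submodule.mem_iInf, Submodule.mem_inf, Module.End.mem_eigenspace_iff,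
    one_smul]
  refine forall_congr' fun c => and_congr ?_ ?_
  · refine forall₂_congr fun S _ => ?_
    rw [PiLp.ext_iff]
    exact forall_congr' fun x => by rw [applyOn_pauliX]
  · constructor
    · intro h x hx
      simp only [IsClosedVec] at hx
      push Not at hx
      obtain ⟨S, hS, hne⟩ := hx
      have := congrArg (fun φ : StackSpace d => φ x) (h S hS)
      simp only [applyOn_pauliZ, sign, hne, if_false] at this
      linear_combination - (1 / 2 : ℂ) * this
    · intro h S hS
      ext x
      rw [applyOn_pauliZ]
      by_cases hx : IsClosedVec d c fun v => x v c
      · rw [hx S hS]; simp [sign]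
      · rw [h x hx, mul_zero]

theorem codeSpace_single_invariant {d : ℕ} {ψ : StackSpace d} (hψ : ψ ∈ codeSpace d) {c : Colour}
    {h : Vertex d → ZMod 2} (hh : h ∈ xSpan d c) : ∀ x, ψ (x + single d c h) = ψ x := by
  induction hh using Submodule.span_induction with
  | mem h hS =>
    obtain ⟨S, hS, rfl⟩ := hS
    exact ((mem_codeSpace.1 hψ) c).1 S hS
  | zero =>
    intro x
    have : x + single d c 0 = x := by
      funext v c'
      simp [single]
    rw [this]
  | add h h' _ _ ih ih' =>
    intro x
    have : x + single d c (h + h') = x + single d c h + single d c h' := by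
      funext v c'
      by_cases e : c' = c <;> simp [single, e, add_assoc]
    rw [this, ih', ih]
  | smul a h _ ih =>
    intro x
    rcases (by decide : ∀ a : ZMod 2, a = 0 ∨ a = 1) a with rfl | rfl
    · have : x + single d c ((0 : ZMod 2) • h) = x := by
        funext v c'
        simp [single]
      rw [this]
    · rw [one_smul]; exact ih x

theorem codeSpace_invariant {d : ℕ} {ψ : StackSpace d} (hψ : ψ ∈ codeSpace d)
    {h : Colour → Vertex d → ZMod 2} (hh : ∀ c, h c ∈ xSpan d c) (x : Config d) :
    ψ (x + fun v c => h c v) = ψ x := by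
  have : (x + fun v c => h c v) =
      x + single d .r (h .r) + single d .g (h .g) + single d .b (h .b) := by
    funext v c
    cases c <;> simp [single]
  rw [this, codeSpace_single_invariant hψ (hh _), codeSpace_single_invariant hψ (hh _),
    codeSpace_single_invariant hψ (hh _)]

/-! ### The encoded states -/

/-- The configurations which occur in an encoded basis state. -/
def InCosets (d : ℕ) (s : Colour → Bool) (a : Colour → ZMod 2) (x : Config d) : Prop :=
  ∀ c, (fun v => x v c) ∈ xCoset d s c (a c)

/-- The amplitude of an encoded basis state. -/
noncomputable def amplitude (d : ℕ) (s : Colour → Bool) (a : Colour → ZMod 2) : ℂ :=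
  ∏ c, ((1 / Real.sqrt (Nat.card (xCoset d s c (a c))) : ℝ) : ℂ)

open Classical in
theorem encodedKet_apply (d : ℕ) (s : Colour → Bool) (c : Colour) (a : ZMod 2)
    (y : Vertex d → ZMod 2) : encodedKet d s c a y =
      if y ∈ xCoset d s c a then ((1 / Real.sqrt (Nat.card (xCoset d s c a)) : ℝ) : ℂ) else 0 := by
  rw [encodedKet, PiLp.smul_apply, smul_eq_mul]
  have : (∑ x : Vertex d → ZMod 2 with x ∈ xCoset d s c a,
      EuclideanSpace.single x (1 : ℂ) : PhysSpace d) y = if y ∈ xCoset d s c a then 1 else 0 := by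
    rw [WithLp.ofLp_sum, Finset.sum_apply]
    simp
  rw [this]
  simp

open Classical in
theorem stackKet_apply (d : ℕ) (s : Colour → Bool) (a : Colour → ZMod 2) (x : Config d) :
    stackKet d s a x = if InCosets d s a x then amplitude d s a else 0 := by
  change ∏ c, encodedKet d s c (a c) (fun v => x v c) = _
  simp only [encodedKet_apply, Fintype.prod_ite_zero, amplitude]
  exact if_congr Iff.rfl rfl rfl

theorem card_xCoset_pos (d : ℕ) (s : Colour → Bool) (c : Colour) (a : ZMod 2) :
    0 < Nat.card (xCoset d s c a) := by
  have : Nonempty (xCoset d s c a) := ⟨⟨_, 0, Submodule.zero_mem _, rfl⟩⟩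
  exact Nat.card_pos

theorem amplitude_ne_zero (d : ℕ) (s : Colour → Bool) (a : Colour → ZMod 2) :
    amplitude d s a ≠ 0 := by
  refine Finset.prod_ne_zero_iff.2 fun c _ => ?_
  have := card_xCoset_pos d s c (a c)
  have h : (0 : ℝ) < Nat.card (xCoset d s c (a c)) := by exact_mod_cast this
  exact_mod_cast (one_div_pos.2 (Real.sqrt_pos.2 h)).ne'

theorem inCosets_unique {d : ℕ} (hd : 2 ≤ d) {s : Colour → Bool} {a b : Colour → ZMod 2}
    {x : Config d} (ha : InCosets d s a x) (hb : InCosets d s b x) : a = b :=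
  funext fun c => xCoset_unique hd (ha c) (hb c)

theorem xCoset_add_mem {d : ℕ} {s : Colour → Bool} {c : Colour} {a : ZMod 2}
    {x h : Vertex d → ZMod 2} (hh : h ∈ xSpan d c) :
    x + h ∈ xCoset d s c a ↔ x ∈ xCoset d s c a := by
  constructor
  · rintro ⟨k, hk, e⟩
    exact ⟨k - h, Submodule.sub_mem _ hk hh, by rw [← add_sub_assoc, ← e, add_sub_cancel_right]⟩
  · rintro ⟨k, hk, rfl⟩
    exact ⟨k + h, Submodule.add_mem _ hk hh, by rw [add_assoc]⟩

theorem stackKet_mem_codeSpace {d : ℕ} (s : Colour → Bool) (a : Colour → ZMod 2) :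
    stackKet d s a ∈ codeSpace d := by
  classical
  refine mem_codeSpace.2 fun c => ⟨fun S hS x => ?_, fun x hx => ?_⟩
  · rw [stackKet_apply, stackKet_apply]
    refine if_congr (forall_congr' fun c' => ?_) rfl rfl
    by_cases h : c' = c
    · subst h
      have : (fun v => (x + single d c' (binVec d S)) v c') = (fun v => x v c') + binVec d S := by
        funext v; simp [single]
      rw [this]
      exact xCoset_add_mem (Submodule.subset_span ⟨S, hS, rfl⟩)
    · have : (fun v => (x + single d c (binVec d S)) v c') = fun v => x v c' := by
        funext v; simp [single, h]
      rw [this]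
  · rw [stackKet_apply]
    exact if_neg fun h => hx (isClosedVec_of_mem_xCoset (h c))

/-- A code state is constant on each product of cosets and zero off the closed configurations, all
of which lie in such products. Its coefficients are its values at one representative of each
product. -/
theorem span_stackKet {d : ℕ} (hd : 2 ≤ d) (s : Colour → Bool) :
    Submodule.span ℂ (Set.range (stackKet d s)) = codeSpace d := by
  classical
  refine le_antisymm (Submodule.span_le.2 ?_) fun ψ hψ => ?_
  · rintro _ ⟨a, rfl⟩
    exact stackKet_mem_codeSpace s a
  · let rep : (Colour → ZMod 2) → Config d :=
      fun a v c => a c * binVec d (boundary d c (s c)) v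
    have key : ψ = ∑ a : Colour → ZMod 2, (ψ (rep a) / amplitude d s a) • stackKet d s a := by
      ext x
      rw [WithLp.ofLp_sum, Finset.sum_apply]
      simp only [PiLp.smul_apply, stackKet_apply, smul_eq_mul]
      by_cases hx : ∀ c, IsClosedVec d c fun v => x v c
      · choose a ha using fun c => exists_mem_xCoset hd s (hx c)
        rw [Finset.sum_eq_single a]
        · rw [if_pos (show InCosets d s a x from ha), div_mul_cancel₀ _ (amplitude_ne_zero d s a)]
          choose h hh e using ha
          have : x = rep a + fun v c => h c v := by
            funext v c
            exact congrFun (e c) v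
          rw [this, codeSpace_invariant hψ hh]
        · intro b _ hb
          rw [if_neg fun h => hb (inCosets_unique hd h ha), mul_zero]
        · intro h; exact absurd (Finset.mem_univ _) h
      · push Not at hx
        obtain ⟨c, hc⟩ := hx
        rw [(mem_codeSpace.1 hψ c).2 x hc]
        symm
        refine Finset.sum_eq_zero fun a _ => ?_
        rw [if_neg fun h => hc (isClosedVec_of_mem_xCoset (h c)), mul_zero]
    rw [key]
    exact Submodule.sum_mem _ fun a _ =>
      Submodule.smul_mem _ _ (Submodule.subset_span ⟨a, rfl⟩)

theorem orthonormal_stackKet {d : ℕ} (hd : 2 ≤ d) (s : Colour → Bool) :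
    Orthonormal ℂ (stackKet d s) := by
  classical
  refine ⟨fun a => ?_, fun a b hab => ?_⟩
  · have sq : ‖stackKet d s a‖ ^ 2 = 1 := by
      have term : ∀ c, ∑ y : Vertex d → ZMod 2, ‖encodedKet d s c (a c) y‖ ^ 2 = 1 := by
        intro c
        have hpos := card_xCoset_pos d s c (a c)
        have h0 : (0 : ℝ) < Nat.card (xCoset d s c (a c)) := by exact_mod_cast hpos
        have : ∀ y, ‖encodedKet d s c (a c) y‖ ^ 2 =
            if y ∈ xCoset d s c (a c) then 1 / (Nat.card (xCoset d s c (a c)) : ℝ) else 0 := by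
          intro y
          rw [encodedKet_apply]
          split_ifs
          · rw [Complex.norm_real, Real.norm_eq_abs, sq_abs, div_pow, Real.sq_sqrt h0.le, one_pow]
          · simp
        simp only [this]
        rw [← Finset.sum_filter, Finset.sum_const, nsmul_eq_mul, ← Fintype.card_subtype,
          ← Nat.card_eq_fintype_card]
        exact mul_one_div_cancel h0.ne'
      rw [EuclideanSpace.norm_sq_eq]
      -- Indexing by colour first makes the sum over configurations factor into one sum per code.
      have swap := (Equiv.piComm fun (_ : Colour) (_ : Vertex d) => ZMod 2).sum_comp
        fun x => ‖stackKet d s a x‖ ^ 2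
      rw [← swap]
      have : ∀ y : Colour → Vertex d → ZMod 2,
          ‖stackKet d s a (Equiv.piComm (fun (_ : Colour) (_ : Vertex d) => ZMod 2) y)‖ ^ 2 =
            ∏ c, ‖encodedKet d s c (a c) (y c)‖ ^ 2 := by
        intro y
        rw [Finset.prod_pow, ← norm_prod]
        rfl
      simp only [this]
      rw [← Fintype.prod_sum fun c y => ‖encodedKet d s c (a c) y‖ ^ 2]
      exact Finset.prod_eq_one fun c _ => term c
    exact (pow_eq_one_iff_of_nonneg (norm_nonneg _) two_ne_zero).1 sq
  · change inner ℂ (stackKet d s a) (stackKet d s b) = 0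
    rw [PiLp.inner_apply]
    -- States with different labels have disjoint supports, so every term of the inner product
    -- vanishes.
    refine Finset.sum_eq_zero fun x _ => ?_
    rw [stackKet_apply, stackKet_apply]
    split_ifs with ha hb
    · exact absurd (inCosets_unique hd ha hb) hab
    all_goals simp

/-- The transversal gate is diagonal: its eigenvalue is the parity of the number of collisions. -/
theorem transversalCCZ_apply {d : ℕ} (ψ : StackSpace d) (x : Config d) :
    transversalCCZ d ψ x = (-1) ^ collisions d (fun c v => x v c) * ψ x := by
  classical
  rw [transversalCCZ, toEuclideanLin_apply_coord]
  have entry : ∀ y : Config d, tensorOp (fun _ : Vertex d => ccz) x y =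
      if y = x then (-1) ^ collisions d (fun c v => x v c) else 0 := by
    intro y
    have pt : ∀ v, ccz (x v) (y v) =
        if y v = x v then (if ∀ c, x v c = 1 then -1 else 1) else 0 := by
      intro v
      simp [ccz, Matrix.diagonal_apply, eq_comm]
    simp only [tensorOp, Matrix.of_apply, pt, Fintype.prod_ite_zero]
    refine if_congr funext_iff.symm ?_ rfl
    rw [Finset.prod_ite, Finset.prod_const, Finset.prod_const_one, mul_one]
    rfl
  simp only [entry, ite_mul, zero_mul, Finset.sum_ite_eq', Finset.mem_univ, if_true]

theorem transversalCCZ_stackKet {d : ℕ} (hd : 2 ≤ d) (s : Colour → Bool) (a : Colour → ZMod 2) :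
    transversalCCZ d (stackKet d s a) =
      (if ∀ c, a c = 1 then (-1 : ℂ) else 1) • stackKet d s a := by
  classical
  ext x
  rw [transversalCCZ_apply, PiLp.smul_apply, smul_eq_mul, stackKet_apply]
  by_cases hx : InCosets d s a x
  · have h := odd_collisions_iff hd s (x := fun c v => x v c) hx
    congr 1
    split_ifs with ha
    · exact (h.2 ha).neg_one_pow
    · exact (Nat.not_odd_iff_even.1 (mt h.1 ha)).neg_one_pow
  · rw [if_neg hx, mul_zero, mul_zero]

end CCZStack

theorem mainTheorem1 (d : ℕ) (hd : 2 ≤ d) (s : CCZStack.Colour → Bool) :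
    -- the eight encoded states are an orthonormal basis of the code space of the stack
    Orthonormal ℂ (CCZStack.stackKet d s) ∧
    Submodule.span ℂ (Set.range (CCZStack.stackKet d s)) = CCZStack.codeSpace d ∧
    -- the transversal gate acts on this basis as the logical `CCZ`
    (∀ a : CCZStack.Colour → ZMod 2,
      CCZStack.transversalCCZ d (CCZStack.stackKet d s a) =
        (if ∀ c, a c = 1 then (-1 : ℂ) else 1) • CCZStack.stackKet d s a) ∧
    -- the number of collisions of three codewords is odd exactly for the logical state `111`
    (∀ (a : CCZStack.Colour → ZMod 2) (x : CCZStack.Colour → CCZStack.Vertex d → ZMod 2),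
      (∀ c, x c ∈ CCZStack.xCoset d s c (a c)) →
        (Odd (CCZStack.collisions d x) ↔ ∀ c, a c = 1)) :=
  ⟨CCZStack.orthonormal_stackKet hd s, CCZStack.span_stackKet hd s,
    CCZStack.transversalCCZ_stackKet hd s, fun _ _ hx => CCZStack.odd_collisions_iff hd s hx⟩
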